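/- **Setting.** $K$ single-antenna UEs are served by $L$ APs with $N$ antennas each; $\tau$ is the pilot length and $\tau_c\ge\tau$ the length of a coherence block. UE $i$ has power $p_i\ge 0$; $\sigma^2>0$ is the noise power; $\rho_{da},\rho_{ad}\in[0,1)$ are the DAC and ADC distortion factors; $\ddot p_i=(1-\rho_{da})p_i$. For a square matrix $A$, $\mathrm{diag}(A)$ is its diagonal part. $\mathcal{CN}(m,R)$ is the circularly symmetric complex Gaussian law. *Channels.* $h_{il}=\bar h_{il}+h_{w,il}\in\mathbb C^N$ with $h_{w,il}\sim\mathcal{CN}(0,R_{il})$, $R_{il}$ positive semidefinite, and $\bar h_{il}=\sqrt{\beta_{il}\kappa_{il}/(\kappa_{il}+1)}\,[1,e^{-j\pi\sin\theta_{il}},\dots,e^{-j(N-1)\pi\sin\theta_{il}}]^T$, where $\beta_{il},\kappa_{il}\ge0$ and $\theta_{il}\in\mathbb R$. *Channel estimation.* UE $i$ uses the column $\phi_{t_i}$ of the $\tau\times\tau$ DFT matrix (with entries of modulus 1), and $\mathcal P_k=\{i: t_i=t_k\}$. AP $l$ receives $Z_l=(1-\rho_{ad})\sum_i\sqrt{\ddot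 p_i}\,h_{il}\phi_{t_i}^T+N_l$, where the columns of $N_l$ are independent $\mathcal{CN}(0,C_{n,l})$ and, with $S_l=\sum_i\ddot p_i(\bar h_{il}\bar h_{il}^H+R_{il})$, $$C_{n,l}=\tfrac{(1-\rho_{ad})^2\rho_{da}}{1-\rho_{da}}S_l+\tfrac{\rho_{ad}(1-\rho_{ad})}{1-\rho_{da}}\mathrm{diag}(S_l)+(1-\rho_{ad})\sigma^2I_N.$$ Put $z^w_{kl}=Z_l\phi_{t_k}^*/\sqrt\tau-(1-\rho_{ad})\sum_{i\in\mathcal P_k}\sqrt{\ddot p_i\tau}\,\bar h_{il}$, $\Psi_{kl}=(1-\rho_{ad})^2\sum_{i\in\mathcal P_k}\ddot p_i\tau R_{il}+C_{n,l}$, and let $\hat h_{kl}=\bar h_{kl}+(1-\rho_{ad})\sqrt{\ddot p_k\tau}\,R_{kl}\Psi_{kl}^{-1}z^w_{kl}$ be the MMSE estimate. *Data phase.* $s_i\sim\mathcal{CN}(0,p_i)$, $n_{da,i}\sim\mathcal{CN}(0,\rho_{da}p_i)$, $n_{an,l}\sim\mathcal{CN}(0,\sigma^2I_N)$, and $n_{ad,l}\sim\mathcal{CN}(0,\rho_{ad}(1-\rho_{ad})\mathrm{diag}(\mathbb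 E[x_lx_l^H]))$ with $x_l=\sum_ih_{il}(\sqrt{1-\rho_{da}}\,s_i+n_{da,i})+n_{an,l}$. The effective noise at AP $l$ is $n_l=(1-\rho_{ad})\sum_ih_{il}n_{da,i}+(1-\rho_{ad})n_{an,l}+n_{ad,l}$. All of $h_{w,il}$, the columns of the $N_l$, $s_i$, $n_{da,i}$, $n_{an,l}$, $n_{ad,l}$ (over all $i$, $l$) are mutually independent. *Spectral efficiency.* $\mathcal M_k\subseteq\{1,\dots,L\}$ is the set of APs that serve UE $k$. Let $D_k$ be the block diagonal matrix whose $l$-th block is $I_N$ if $l\in\mathcal M_k$ and $0$ otherwise, and $\mathcal Q_k=\{i:D_kD_i\ne0\}$. With MRC, i.e. with combining vectors $\hat h_{kl}$, put $g_{ki}=[\hat h_{kl}^Hh_{il}\mid l\in\mathcal M_k]^T$ and $f_k=[\hat h_{kl}^Hn_l\mid l\in\mathcal M_k]^T$. For a CPU weighting vector $a_k$ the UL SE of UE $k$ is $$R_k^d=\Big(1-\frac{\tau}{\tau_c}\Big)\log_2\Big(1+\frac{(1-\rho_{ad})^2\ddot p_k|a_k^H\mathbb E[g_{kk}]|^2}{(1-\rho_{ad})^2\sum_{i=1}^K\ddot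 p_i\mathbb E[|a_k^Hg_{ki}|^2]-(1-\rho_{ad})^2\ddot p_k|a_k^H\mathbb E[g_{kk}]|^2+a_k^H\mathbb E[f_kf_k^H]a_k}\Big).$$ *Closed-form quantities.* For $l\in\mathcal M_k$ let $\lambda_{kl}^i=\bar h_{kl}^H\bar h_{il}$, $b_{kl}^i=(1-\rho_{ad})^2\tau\sqrt{\ddot p_k\ddot p_i}\,\mathrm{tr}(R_{il}\Psi_{kl}^{-1}R_{kl})$, $$c_{kl}^i=(1-\rho_{ad})^2\tau\ddot p_k\,\mathrm{tr}(R_{il}R_{kl}\Psi_{kl}^{-1}R_{kl})+\bar h_{kl}^HR_{il}\bar h_{kl}+(1-\rho_{ad})^2\tau\ddot p_k\,\bar h_{il}^HR_{kl}\Psi_{kl}^{-1}R_{kl}\bar h_{il},$$ and, with $\Delta_l=\mathrm{diag}(\sum_i\ddot p_iR_{il})$, $$d_{kl}=\tfrac{\rho_{ad}(1-\rho_{ad})}{1-\rho_{da}}\bar h_{kl}^H\Delta_l\bar h_{kl}+\tfrac{\rho_{ad}(1-\rho_{ad})^3}{1-\rho_{da}}\tau\ddot p_k\mathrm{tr}(\Delta_lR_{kl}\Psi_{kl}^{-1}R_{kl})+(1-\rho_{ad})\Big[\sigma^2+\tfrac{\rho_{ad}}{1-\rho_{da}}\sum_i\tfrac{\ddot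 p_i\beta_{il}\kappa_{il}}{\kappa_{il}+1}\Big]\big[\bar h_{kl}^H\bar h_{kl}+(1-\rho_{ad})^2\tau\ddot p_k\mathrm{tr}(R_{kl}\Psi_{kl}^{-1}R_{kl})\big].$$ Let $\lambda_k^i,b_k^i$ be the vectors and $\Lambda(c_k^i),\Lambda(d_k)$ the diagonal matrices with these entries, $l\in\mathcal M_k$. For a set $Q$ of UEs let $$C_k(Q)=\tfrac{(1-\rho_{ad})^2}{1-\rho_{da}}\Big\{\sum_{i\in Q}\ddot p_i\big[\lambda_k^i(\lambda_k^i)^H+\Lambda(c_k^i)\big]+\sum_{i\in\mathcal P_k\cap Q}\ddot p_i\big[b_k^i(b_k^i)^H+b_k^i(\lambda_k^i)^H+\lambda_k^i(b_k^i)^H\big]\Big\}-(1-\rho_{ad})^2\ddot p_k(\lambda_k^k+b_k^k)(\lambda_k^k+b_k^k)^H+\Lambda(d_k),$$ $C_k=C_k(\{1,\dots,K\})$ and $C_k^P=C_k(\mathcal Q_k)$. The P-LSFD vector is $$a_k^{P-MR}=\Big[\Lambda(d_k)+\tfrac{(1-\rho_{ad})^2}{1-\rho_{da}}\sum_{i\in\mathcal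 Q_k}\ddot p_i\mathbb E[g_{ki}g_{ki}^H]-(1-\rho_{ad})^2\ddot p_k\mathbb E[g_{kk}]\mathbb E[g_{kk}^H]\Big]^{-1}\mathbb E[g_{kk}].$$ **Corollary.** The P-LSFD vector equals $a_k^{P-MR}=(C_k^P)^{-1}(\lambda_k^k+b_k^k)$, and with MRC at each AP and $a_k=a_k^{P-MR}$ at the CPU, the UL SE of UE $k$ is $$R_k^d=\Big(1-\frac{\tau}{\tau_c}\Big)\log_2\Big(1+\frac{(1-\rho_{ad})^2\ddot p_k\big|(a_k^{P-MR})^H(\lambda_k^k+b_k^k)\big|^2}{(a_k^{P-MR})^HC_k\,a_k^{P-MR}}\Big).$$ These formulas are meaningful: if $p_k>0$, $\mathcal M_k\neq\emptyset$ and, for each $l\in\mathcal M_k$, $\bar h_{kl}\ne0$ or $R_{kl}\ne0$, then $C_k^P$ is invertible and the denominator $(a_k^{P-MR})^HC_k\,a_k^{P-MR}$ is positive. -/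

import Mathlib

open MeasureTheory ProbabilityTheory Matrix
open scoped ComplexConjugate ComplexOrder

noncomputable section

namespace SCF

/-- The random vector `X` is circularly symmetric complex Gaussian `CN(m, C)`: it is Gaussian (as a
random vector of the underlying real vector space), has mean `m`, covariance matrix
`E[(X - m)(X - m)ᴴ] = C` and pseudo-covariance matrix `E[(X - m)(X - m)ᵀ] = 0`. -/
structure IsCN {Ω : Type*} [MeasurableSpace Ω] (P : Measure Ω) {n : ℕ}
    (X : Ω → Fin n → ℂ) (m : Fin n → ℂ) (C : Matrix (Fin n) (Fin n) ℂ) : Prop where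
  gaussian : HasGaussianLaw X P
  mean : ∀ a, ∫ ω, X ω a ∂P = m a
  cov : ∀ a b, ∫ ω, (X ω a - m a) * conj (X ω b - m b) ∂P = C a b
  pseudoCov : ∀ a b, ∫ ω, (X ω a - m a) * (X ω b - m b) ∂P = 0

/-- Deterministic parameters of the uplink of a cell-free network with `K` single-antenna UEs, `L`
APs of `N` antennas each, and pilots of length `τ`. UEs, APs, antennas and pilot symbols are
numbered from `0`. -/
structure Network (K L N τ : ℕ) where
  /-- transmit power of each UE -/
  p : Fin K → ℝ
  p_nonneg : ∀ i, 0 ≤ p i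
  /-- variance of the receiver noise -/
  σsq : ℝ
  σsq_pos : 0 < σsq
  /-- distortion factor of the DACs -/
  ρda : ℝ
  ρda_nonneg : 0 ≤ ρda
  ρda_lt_one : ρda < 1
  /-- distortion factor of the ADCs -/
  ρad : ℝ
  ρad_nonneg : 0 ≤ ρad
  ρad_lt_one : ρad < 1
  /-- large-scale fading (received power) between a UE and an AP -/
  β : Fin K → Fin L → ℝ
  β_nonneg : ∀ i l, 0 ≤ β i l
  /-- Rician factors -/
  κ : Fin K → Fin L → ℝ
  κ_nonneg : ∀ i l, 0 ≤ κ i l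
  /-- angles of arrival of the line-of-sight paths -/
  θ : Fin K → Fin L → ℝ
  /-- spatial correlation matrices of the non-line-of-sight parts -/
  R : Fin K → Fin L → Matrix (Fin N) (Fin N) ℂ
  R_psd : ∀ i l, (R i l).PosSemidef
  /-- index of the pilot assigned to each UE -/
  pilot : Fin K → Fin τ
  /-- cluster of APs that serve each UE -/
  M : Fin K → Finset (Fin L)

namespace Network

variable {K L N τ : ℕ} (W : Network K L N τ)

/-- The effective power `(1 - ρ_da) p_i`. -/
def pdd (i : Fin K) : ℝ := (1 - W.ρda) * W.p i

/-- Large-scale fading of the line-of-sight path. -/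
def βLOS (i : Fin K) (l : Fin L) : ℝ := W.κ i l * W.β i l / (W.κ i l + 1)

/-- Line-of-sight part of the channel: half-wavelength uniform linear array. -/
def hbar (i : Fin K) (l : Fin L) : Fin N → ℂ := fun n =>
  (Real.sqrt (W.βLOS i l) : ℂ) *
    Complex.exp (-Complex.I * ((n : ℕ) : ℂ) * (Real.pi : ℂ) * (Real.sin (W.θ i l) : ℂ))

/-- The UEs that share the pilot of UE `k`. -/
def PSet (k : Fin K) : Finset (Fin K) := Finset.univ.filter fun i => W.pilot i = W.pilot k

/-- The `LN × LN` block diagonal matrix with blocks `D_{kl} = I_N` if AP `l` serves UE `k` and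
`D_{kl} = 0` otherwise. -/
def D (k : Fin K) : Matrix (Fin N × Fin L) (Fin N × Fin L) ℂ :=
  blockDiagonal fun l => if l ∈ W.M k then 1 else 0

open Classical in
/-- The UEs `i` with `D_k D_i ≠ 0`. -/
def QSet (k : Fin K) : Finset (Fin K) := Finset.univ.filter fun i => W.D k * W.D i ≠ 0

/-- `H̄_l P̈ H̄_lᴴ + ∑ i, p̈_i R_{il}`. -/
def S (l : Fin L) : Matrix (Fin N) (Fin N) ℂ :=
  ∑ i, (W.pdd i : ℂ) • (vecMulVec (W.hbar i l) (star (W.hbar i l)) + W.R i l)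

/-- Covariance matrix of the effective noise at AP `l`. -/
def Cn (l : Fin L) : Matrix (Fin N) (Fin N) ℂ :=
  (((1 - W.ρad) ^ 2 * W.ρda / (1 - W.ρda) : ℝ) : ℂ) • W.S l
    + ((W.ρad * (1 - W.ρad) / (1 - W.ρda) : ℝ) : ℂ) • diagonal (diag (W.S l))
    + (((1 - W.ρad) * W.σsq : ℝ) : ℂ) • (1 : Matrix (Fin N) (Fin N) ℂ)

/-- The matrix `Ψ` of the pilot used by UE `k`, at AP `l`. -/
def Psi (k : Fin K) (l : Fin L) : Matrix (Fin N) (Fin N) ℂ :=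
  (((1 - W.ρad) ^ 2 : ℝ) : ℂ) • ∑ i ∈ W.PSet k, ((W.pdd i * τ : ℝ) : ℂ) • W.R i l + W.Cn l

/-- The pilot sequences: columns of the `τ × τ` discrete Fourier transform matrix. -/
def φ (_W : Network K L N τ) (t : Fin τ) : Fin τ → ℂ := fun t' =>
  Complex.exp (-Complex.I * 2 * (Real.pi : ℂ) * ((t : ℕ) : ℂ) * ((t' : ℕ) : ℂ) / (τ : ℂ))

/-! Closed-form quantities. -/

/-- `b_{kl}^i`; the vector `b_k^i` is its restriction to the cluster of UE `k`. -/
def b (k i : Fin K) (l : Fin L) : ℂ :=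
  (((1 - W.ρad) ^ 2 * τ * Real.sqrt (W.pdd k * W.pdd i) : ℝ) : ℂ)
    * trace (W.R i l * (W.Psi k l)⁻¹ * W.R k l)

/-- `λ_{kl}^i`. -/
def lam (k i : Fin K) (l : Fin L) : ℂ := star (W.hbar k l) ⬝ᵥ W.hbar i l

/-- `c_{kl}^i`. -/
def c (k i : Fin K) (l : Fin L) : ℂ :=
  (((1 - W.ρad) ^ 2 * τ * W.pdd k : ℝ) : ℂ)
      * trace (W.R i l * W.R k l * (W.Psi k l)⁻¹ * W.R k l)
    + star (W.hbar k l) ⬝ᵥ (W.R i l *ᵥ W.hbar k l)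
    + (((1 - W.ρad) ^ 2 * τ * W.pdd k : ℝ) : ℂ)
      * (star (W.hbar i l) ⬝ᵥ ((W.R k l * (W.Psi k l)⁻¹ * W.R k l) *ᵥ W.hbar i l))

/-- `d_{kl}`. -/
def d (k : Fin K) (l : Fin L) : ℂ :=
  let ΔR : Matrix (Fin N) (Fin N) ℂ := diagonal (diag (∑ i, (W.pdd i : ℂ) • W.R i l))
  ((W.ρad * (1 - W.ρad) / (1 - W.ρda) : ℝ) : ℂ) * (star (W.hbar k l) ⬝ᵥ (ΔR *ᵥ W.hbar k l))
    + ((W.ρad * (1 - W.ρad) ^ 3 / (1 - W.ρda) * τ * W.pdd k : ℝ) : ℂ)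
      * trace (ΔR * W.R k l * (W.Psi k l)⁻¹ * W.R k l)
    + (((1 - W.ρad) * (W.σsq + W.ρad / (1 - W.ρda)
          * ∑ i, W.pdd i * W.β i l * W.κ i l / (W.κ i l + 1)) : ℝ) : ℂ)
      * (star (W.hbar k l) ⬝ᵥ W.hbar k l
        + (((1 - W.ρad) ^ 2 * τ * W.pdd k : ℝ) : ℂ)
          * trace (W.R k l * (W.Psi k l)⁻¹ * W.R k l))

/-- The vector `λ_k^i`, indexed by the APs that serve UE `k`. -/
def lamV (k i : Fin K) : W.M k → ℂ := fun l => W.lam k i l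

/-- The vector `b_k^i`, indexed by the APs that serve UE `k`. -/
def bV (k i : Fin K) : W.M k → ℂ := fun l => W.b k i l

/-- The matrix `C_k` with the sum over all UEs replaced by the sum over the set `Q` of UEs. -/
def CMat (k : Fin K) (Q : Finset (Fin K)) : Matrix (W.M k) (W.M k) ℂ :=
  (((1 - W.ρad) ^ 2 / (1 - W.ρda) : ℝ) : ℂ) •
      (∑ i ∈ Q, (W.pdd i : ℂ) •
          (vecMulVec (W.lamV k i) (star (W.lamV k i)) + diagonal fun l : W.M k => W.c k i l)
        + ∑ i ∈ W.PSet k ∩ Q, (W.pdd i : ℂ) •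
          (vecMulVec (W.bV k i) (star (W.bV k i)) + vecMulVec (W.bV k i) (star (W.lamV k i))
            + vecMulVec (W.lamV k i) (star (W.bV k i))))
    - (((1 - W.ρad) ^ 2 * W.pdd k : ℝ) : ℂ) •
      vecMulVec (W.lamV k k + W.bV k k) (star (W.lamV k k + W.bV k k))
    + diagonal fun l : W.M k => W.d k l

/-- The matrix `C_k`. -/
def C (k : Fin K) : Matrix (W.M k) (W.M k) ℂ := W.CMat k Finset.univ

/-- The matrix `C_k^P`. -/
def CP (k : Fin K) : Matrix (W.M k) (W.M k) ℂ := W.CMat k (W.QSet k)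

end Network

/-- The elementary sources of randomness. -/
inductive Source (K L τ : ℕ) : Type
  /-- non-line-of-sight part of the channel between a UE and an AP -/
  | chan (i : Fin K) (l : Fin L)
  /-- effective noise at an AP during one pilot symbol -/
  | pilotNoise (l : Fin L) (t : Fin τ)
  /-- data symbol of a UE -/
  | sig (i : Fin K)
  /-- DAC noise of a UE in the data phase -/
  | dac (i : Fin K)
  /-- receiver noise at an AP in the data phase -/
  | recv (l : Fin L)
  /-- ADC noise at an AP in the data phase -/
  | adc (l : Fin L)

/-- Dimension of a source: `N` for the vectors at an AP, `1` for the scalars at a UE. -/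
def Source.dim {K L τ : ℕ} (N : ℕ) : Source K L τ → ℕ
  | .chan _ _ => N
  | .pilotNoise _ _ => N
  | .sig _ => 1
  | .dac _ => 1
  | .recv _ => N
  | .adc _ => N

/-- A family of random vectors on `Ω`, one for each source. -/
abbrev Sources (K L N τ : ℕ) (Ω : Type*) : Type _ :=
  (s : Source K L τ) → Ω → Fin (s.dim N) → ℂ

namespace Network

variable {K L N τ : ℕ} (W : Network K L N τ) {Ω : Type*} [MeasurableSpace Ω]
  (P : Measure Ω) (X : Sources K L N τ Ω)

/-- Non-line-of-sight part of the channel. -/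
def hw (_W : Network K L N τ) (X : Sources K L N τ Ω) (i : Fin K) (l : Fin L) :
    Ω → Fin N → ℂ := X (.chan i l)

/-- The channel `h_{il} = h̄_{il} + h_{w,il}`. -/
def h (i : Fin K) (l : Fin L) : Ω → Fin N → ℂ := fun ω => W.hbar i l + W.hw X i l ω

/-- Data symbol `s_i` (a scalar). -/
def s (_W : Network K L N τ) (X : Sources K L N τ Ω) (i : Fin K) : Ω → ℂ :=
  fun ω => X (.sig i) ω (0 : Fin 1)

/-- DAC noise `n_{da,i}` of the data phase (a scalar). -/
def nda (_W : Network K L N τ) (X : Sources K L N τ Ω) (i : Fin K) : Ω → ℂ :=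
  fun ω => X (.dac i) ω (0 : Fin 1)

/-- Receiver noise `n_{an,l}` of the data phase. -/
def nan (_W : Network K L N τ) (X : Sources K L N τ Ω) (l : Fin L) : Ω → Fin N → ℂ := X (.recv l)

/-- ADC noise `n_{ad,l}` of the data phase. -/
def nad (_W : Network K L N τ) (X : Sources K L N τ Ω) (l : Fin L) : Ω → Fin N → ℂ := X (.adc l)

/-- Input of the ADCs at AP `l` in the data phase:
`∑ i, h_{il} (√(1 - ρ_da) s_i + n_{da,i}) + n_{an,l}`. -/
def adcIn (l : Fin L) : Ω → Fin N → ℂ := fun ω =>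
  ∑ i, ((Real.sqrt (1 - W.ρda) : ℂ) * W.s X i ω + W.nda X i ω) • W.h X i l ω + W.nan X l ω

/-- Covariance matrix `ρ_ad (1 - ρ_ad) diag(E[x xᴴ])` of the ADC noise for the ADC input `x`. -/
def Cad (l : Fin L) : Matrix (Fin N) (Fin N) ℂ :=
  ((W.ρad * (1 - W.ρad) : ℝ) : ℂ) •
    diagonal fun n => ∫ ω, W.adcIn X l ω n * conj (W.adcIn X l ω n) ∂P

/-- The statistical model: all sources are independent, circularly symmetric complex Gaussian with
mean zero, and have the covariance matrices of the system model. -/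
structure IsModel : Prop where
  indep : iIndepFun X P
  chan : ∀ i l, IsCN P (W.hw X i l) 0 (W.R i l)
  pilotNoise : ∀ l t, IsCN (n := N) P (X (.pilotNoise l t)) 0 (W.Cn l)
  sig : ∀ i, IsCN (n := 1) P (X (.sig i)) 0 ((W.p i : ℂ) • 1)
  dac : ∀ i, IsCN (n := 1) P (X (.dac i)) 0 (((W.ρda * W.p i : ℝ) : ℂ) • 1)
  recv : ∀ l, IsCN P (W.nan X l) 0 ((W.σsq : ℂ) • 1)
  adc : ∀ l, IsCN P (W.nad X l) 0 (W.Cad P X l)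

/-! Pilot phase and channel estimation. -/

/-- The quantized received pilot matrix at AP `l`. -/
def Z (l : Fin L) : Ω → Matrix (Fin N) (Fin τ) ℂ := fun ω =>
  ((1 - W.ρad : ℝ) : ℂ) •
      ∑ i, (Real.sqrt (W.pdd i) : ℂ) • vecMulVec (W.h X i l ω) (W.φ (W.pilot i))
    + Matrix.of fun n t => X (.pilotNoise l t) ω n

/-- The received pilot matrix correlated with the pilot of UE `k`: `Z_l φ* / √τ`. -/
def z (k : Fin K) (l : Fin L) : Ω → Fin N → ℂ := fun ω =>
  ((1 / Real.sqrt τ : ℝ) : ℂ) • (W.Z X l ω *ᵥ star (W.φ (W.pilot k)))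

/-- The correlated pilot signal without its known line-of-sight part; since the pilots are
orthogonal, this is `(1 - ρ_ad) ∑ i ∈ P_k, √(p̈_i τ) h_{w,il}` plus noise. -/
def zw (k : Fin K) (l : Fin L) : Ω → Fin N → ℂ := fun ω =>
  W.z X k l ω - ((1 - W.ρad : ℝ) : ℂ) •
    ∑ i ∈ W.PSet k, (Real.sqrt (W.pdd i * τ) : ℂ) • W.hbar i l

/-- The MMSE estimate `ĥ_{kl} = h̄_{kl} + (1 - ρ_ad) √(p̈_k τ) R_{kl} Ψ⁻¹ zw`. -/
def hhat (k : Fin K) (l : Fin L) : Ω → Fin N → ℂ := fun ω =>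
  W.hbar k l + (((1 - W.ρad) * Real.sqrt (W.pdd k * τ) : ℝ) : ℂ) •
    ((W.R k l * (W.Psi k l)⁻¹) *ᵥ W.zw X k l ω)

/-! Data phase. -/

/-- The effective noise `n_l` at AP `l` in the data phase. -/
def nEff (l : Fin L) : Ω → Fin N → ℂ := fun ω =>
  ((1 - W.ρad : ℝ) : ℂ) • ∑ i, W.nda X i ω • W.h X i l ω
    + ((1 - W.ρad : ℝ) : ℂ) • W.nan X l ω + W.nad X l ω

/-- `g_{ki} = [v_{kl}ᴴ h_{il} | l ∈ M_k]ᵀ`, for the combining vectors `v`. -/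
def g (v : Fin K → Fin L → Ω → Fin N → ℂ) (k i : Fin K) : Ω → W.M k → ℂ :=
  fun ω l => star (v k l ω) ⬝ᵥ W.h X i l ω

/-- `f_k = [v_{kl}ᴴ n_l | l ∈ M_k]ᵀ`, for the combining vectors `v`. -/
def f (v : Fin K → Fin L → Ω → Fin N → ℂ) (k : Fin K) : Ω → W.M k → ℂ :=
  fun ω l => star (v k l ω) ⬝ᵥ W.nEff X l ω

end Network

/-- Entrywise expectation of a random vector. -/
def expVec {Ω ι : Type*} [MeasurableSpace Ω] (P : Measure Ω) (Y : Ω → ι → ℂ) : ι → ℂ :=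
  fun l => ∫ ω, Y ω l ∂P

/-- `E[Y Yᴴ]`. -/
def expOuter {Ω ι : Type*} [MeasurableSpace Ω] (P : Measure Ω) (Y : Ω → ι → ℂ) : Matrix ι ι ℂ :=
  Matrix.of fun l l' => ∫ ω, Y ω l * conj (Y ω l') ∂P

namespace Network

variable {K L N τ : ℕ} (W : Network K L N τ) {Ω : Type*} [MeasurableSpace Ω]
  (P : Measure Ω) (X : Sources K L N τ Ω)

/-- The uplink spectral efficiency of UE `k` in the distributed scheme, for coherence blocks of
`τc` symbols, combining vectors `v` at the APs and the weighting vector `a` at the CPU. -/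
def ulSE (τc : ℕ) (v : Fin K → Fin L → Ω → Fin N → ℂ) (k : Fin K) (a : W.M k → ℂ) : ℝ :=
  let sigPow : ℝ := (1 - W.ρad) ^ 2 * W.pdd k * ‖star a ⬝ᵥ expVec P (W.g X v k k)‖ ^ 2
  (1 - (τ : ℝ) / (τc : ℝ)) * Real.logb 2 (1 + sigPow /
    ((1 - W.ρad) ^ 2 * ∑ i, W.pdd i * ∫ ω, ‖star a ⬝ᵥ W.g X v k i ω‖ ^ 2 ∂P
      - sigPow + (star a ⬝ᵥ (expOuter P (W.f X v k) *ᵥ a)).re))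

/-- The partial large-scale fading decoding vector for MRC, in terms of expectations:
`[diag(d_{kl}) + (1 - ρ_ad)² / (1 - ρ_da) ∑ i ∈ Q_k, p̈_i E[g_{ki} g_{ki}ᴴ]
  - (1 - ρ_ad)² p̈_k E[g_{kk}] E[g_{kk}ᴴ]]⁻¹ E[g_{kk}]`. -/
def aPMR (k : Fin K) : W.M k → ℂ :=
  let g := W.g X (W.hhat X) k
  ((diagonal fun l : W.M k => W.d k l)
      + (((1 - W.ρad) ^ 2 / (1 - W.ρda) : ℝ) : ℂ) •
        ∑ i ∈ W.QSet k, (W.pdd i : ℂ) • expOuter P (g i)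
      - (((1 - W.ρad) ^ 2 * W.pdd k : ℝ) : ℂ) •
        vecMulVec (expVec P (g k)) (star (expVec P (g k))))⁻¹ *ᵥ expVec P (g k)

end Network

end SCF

end

/-!
The channels `h_{il}` and the estimates `ĥ_{kl}` are noncentral, jointly circularly symmetric
Gaussian vectors, so Isserlis' theorem expresses the moments of the inner products `ĥ_{kl}ᴴ h_{il}`
in terms of second moments. Since the pilots are orthogonal, `z^w_{kl}` has covariance matrix
`Ψ_{kl}` and is correlated only with the channels of the UEs that share its pilot; this gives
`E[g_{ki}]` and `E[g_{ki} g_{ki}ᴴ]`.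

In `f_k` the noises of the data phase are independent of the coefficients, which are functions of
the channels and the pilot noise. The DAC noise therefore contributes a multiple of
`∑ i, p̈_i E[g_{ki} g_{ki}ᴴ]`, which turns the factor `(1 - ρ_ad)²` of the interference into
`(1 - ρ_ad)² / (1 - ρ_da)`, and the remaining noises contribute `Λ(d_k)`.

In `C_k(Q)` with `k ∈ Q` the factor `1 / (1 - ρ_da) ≥ 1` makes the self-interference outweigh the
subtracted signal term, so `C_k(Q)` is positive semidefinite plus the positive diagonal `Λ(d_k)`.
-/

noncomputable section

namespace SCF

/-- `E` has the moments of orders one, three and four of a centred Gaussian law on each element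
of `S`. The elements of `A` play the role of random variables, `E` that of the expectation. -/
structure HasGaussianMoments {k A : Type*} [Field k] [CommRing A] [Algebra k A]
    (E : A →ₗ[k] k) (S : AddSubgroup A) : Prop where
  map_self : ∀ y ∈ S, E y = 0
  map_pow_three : ∀ y ∈ S, E (y ^ 3) = 0
  map_pow_four : ∀ y ∈ S, E (y ^ 4) = 3 * E (y ^ 2) ^ 2

namespace HasGaussianMoments

variable {k A : Type*} [Field k] [CharZero k] [CommRing A] [Algebra k A]
  {E : A →ₗ[k] k} {S : AddSubgroup A} {x y z w : A}

lemma map_sq_mul (hE : HasGaussianMoments E S) (hx : x ∈ S) (hy : y ∈ S) : E (x ^ 2 * y) = 0 := by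
  have hadd := hE.map_pow_three _ (S.add_mem hx hy)
  have hsub := hE.map_pow_three _ (S.sub_mem hx hy)
  have polarization : 6 • (x ^ 2 * y) = (x + y) ^ 3 - (x - y) ^ 3 - 2 • y ^ 3 := by ring
  have h6 := congrArg E polarization
  rw [map_sub, map_sub, map_nsmul, map_nsmul, hadd, hsub, hE.map_pow_three y hy] at h6
  simpa using h6

lemma map_mul_mul (hE : HasGaussianMoments E S) (hx : x ∈ S) (hy : y ∈ S) (hz : z ∈ S) :
    E (x * y * z) = 0 := by
  have polarization : 4 • (x * y * z) = (x + y) ^ 2 * z - (x - y) ^ 2 * z := by ring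
  have h4 := congrArg E polarization
  rw [map_sub, map_nsmul, hE.map_sq_mul (S.add_mem hx hy) hz,
    hE.map_sq_mul (S.sub_mem hx hy) hz] at h4
  simpa using h4

lemma map_sq_mul_sq (hE : HasGaussianMoments E S) (hx : x ∈ S) (hy : y ∈ S) :
    E (x ^ 2 * y ^ 2) = E (x ^ 2) * E (y ^ 2) + 2 * E (x * y) ^ 2 := by
  have hadd := hE.map_pow_four _ (S.add_mem hx hy)
  have hsub := hE.map_pow_four _ (S.sub_mem hx hy)
  have polarization : 12 • (x ^ 2 * y ^ 2) =
      (x + y) ^ 4 + (x - y) ^ 4 - 2 • x ^ 4 - 2 • y ^ 4 := by ring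
  have sq_add : (x + y) ^ 2 = x ^ 2 + 2 • (x * y) + y ^ 2 := by ring
  have sq_sub : (x - y) ^ 2 = x ^ 2 - 2 • (x * y) + y ^ 2 := by ring
  have h12 := congrArg E polarization
  simp only [map_sub, map_add, map_nsmul, hadd, hsub, sq_add, sq_sub, hE.map_pow_four x hx,
    hE.map_pow_four y hy] at h12
  linear_combination h12 / 12

lemma map_mul_mul_sq (hE : HasGaussianMoments E S) (hx : x ∈ S) (hy : y ∈ S) (hz : z ∈ S) :
    E (x * y * z ^ 2) = E (x * y) * E (z ^ 2) + 2 * (E (x * z) * E (y * z)) := by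
  have polarization : 4 • (x * y * z ^ 2) = (x + y) ^ 2 * z ^ 2 - (x - y) ^ 2 * z ^ 2 := by ring
  have sq_add : (x + y) ^ 2 = x ^ 2 + 2 • (x * y) + y ^ 2 := by ring
  have sq_sub : (x - y) ^ 2 = x ^ 2 - 2 • (x * y) + y ^ 2 := by ring
  have h4 := congrArg E polarization
  rw [map_sub, hE.map_sq_mul_sq (S.add_mem hx hy) hz, hE.map_sq_mul_sq (S.sub_mem hx hy) hz] at h4
  simp only [sq_add, sq_sub, add_mul, sub_mul, map_sub, map_add, map_nsmul] at h4
  linear_combination h4 / 4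

/-- Isserlis' theorem for four factors. -/
lemma map_mul_mul_mul (hE : HasGaussianMoments E S) (hx : x ∈ S) (hy : y ∈ S) (hz : z ∈ S)
    (hw : w ∈ S) :
    E (x * y * (z * w)) =
      E (x * y) * E (z * w) + E (x * z) * E (y * w) + E (x * w) * E (y * z) := by
  have polarization : 4 • (x * y * (z * w)) = x * y * (z + w) ^ 2 - x * y * (z - w) ^ 2 := by ring
  have sq_add : (z + w) ^ 2 = z ^ 2 + 2 • (z * w) + w ^ 2 := by ring
  have sq_sub : (z - w) ^ 2 = z ^ 2 - 2 • (z * w) + w ^ 2 := by ring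
  have h4 := congrArg E polarization
  rw [map_sub, hE.map_mul_mul_sq hx hy (S.add_mem hz hw),
    hE.map_mul_mul_sq hx hy (S.sub_mem hz hw)] at h4
  simp only [sq_add, sq_sub, mul_add, mul_sub, map_sub, map_add, map_nsmul] at h4
  linear_combination h4 / 4

lemma map_add_mul_add_mul_add_mul_add (hE : HasGaussianMoments E S) (hE_one : E 1 = 1)
    (hx : x ∈ S) (hy : y ∈ S) (hz : z ∈ S) (hw : w ∈ S) (a b c d : k) :
    E ((algebraMap k A a + x) * (algebraMap k A b + y) *
        ((algebraMap k A c + z) * (algebraMap k A d + w))) =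
      E ((algebraMap k A a + x) * (algebraMap k A b + y)) *
          E ((algebraMap k A c + z) * (algebraMap k A d + w)) +
        (a * c * E (y * w) + b * d * E (x * z) + E (x * z) * E (y * w)) +
        (a * d * E (y * z) + b * c * E (x * w) + E (x * w) * E (y * z)) := by
  have expand_two (a b : k) (x y : A) : (algebraMap k A a + x) * (algebraMap k A b + y) =
      (a * b) • (1 : A) + a • y + b • x + x * y := by
    simp only [Algebra.smul_def, map_mul]
    ring
  simp only [expand_two, add_mul, mul_add, smul_mul_assoc, mul_smul_comm,
    one_mul, mul_one, map_add, map_smul, smul_eq_mul, ← mul_assoc, hE_one, hE.map_self _ hx,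
    hE.map_self _ hy, hE.map_self _ hz, hE.map_self _ hw, hE.map_mul_mul hx hy hz,
    hE.map_mul_mul hx hy hw, hE.map_mul_mul hx hz hw, hE.map_mul_mul hy hz hw]
  rw [mul_assoc (x * y) z w, hE.map_mul_mul_mul hx hy hz hw]
  ring

/-- This passes from real linear forms to complex linear forms, with `c` the imaginary unit. -/
lemma of_forall_exists_add_smul (hE : HasGaussianMoments E S) (c : k) {T : AddSubgroup A}
    (hT : ∀ y ∈ T, ∃ a ∈ S, ∃ b ∈ S, y = a + c • b) : HasGaussianMoments E T where
  map_self y hy := by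
    obtain ⟨a, ha, b, hb, rfl⟩ := hT y hy
    simp [hE.map_self a ha, hE.map_self b hb]
  map_pow_three y hy := by
    obtain ⟨a, ha, b, hb, rfl⟩ := hT y hy
    have expand : (a + c • b) ^ 3 =
        a ^ 3 + (3 * c) • (a ^ 2 * b) + (3 * c ^ 2) • (b ^ 2 * a) + c ^ 3 • b ^ 3 := by
      simp only [Algebra.smul_def, map_mul, map_pow, map_ofNat]
      ring
    simp [expand, hE.map_pow_three, hE.map_sq_mul, ha, hb]
  map_pow_four y hy := by
    obtain ⟨a, ha, b, hb, rfl⟩ := hT y hy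
    have expand_four : (a + c • b) ^ 4 = a ^ 4 + (4 * c) • (a * b * a ^ 2)
        + (6 * c ^ 2) • (a ^ 2 * b ^ 2) + (4 * c ^ 3) • (a * b * b ^ 2) + c ^ 4 • b ^ 4 := by
      simp only [Algebra.smul_def, map_mul, map_pow, map_ofNat]
      ring
    have expand_two : (a + c • b) ^ 2 = a ^ 2 + (2 * c) • (a * b) + c ^ 2 • b ^ 2 := by
      simp only [Algebra.smul_def, map_mul, map_pow, map_ofNat]
      ring
    rw [expand_four, expand_two]
    simp only [map_add, map_smul, smul_eq_mul, hE.map_pow_four a ha, hE.map_pow_four b hb,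
      hE.map_sq_mul_sq ha hb, hE.map_mul_mul_sq ha hb ha, hE.map_mul_mul_sq ha hb hb, ← sq,
      mul_comm b a]
    ring

end HasGaussianMoments

section MomentAlgebra

open scoped ENNReal

variable {Ω : Type*} [MeasurableSpace Ω] (P : Measure Ω) [IsProbabilityMeasure P]

/-- The complex random variables with finite absolute moments of all orders. On this algebra the
expectation is a linear functional, with no integrability side conditions. -/
def momentAlgebra : StarSubalgebra ℂ (Ω → ℂ) where
  carrier := {Y | ∀ p : ℝ≥0∞, p ≠ ∞ → MemLp Y p P}
  mul_mem' {a b} ha hb p hp := by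
    have : ENNReal.HolderTriple (p * 2) (p * 2) p := by
      constructor
      rw [ENNReal.mul_inv (by simp) (by simp), ← mul_add, ENNReal.inv_two_add_inv_two, mul_one]
    exact MemLp.mul (p := p * 2) (q := p * 2)
      (hb _ (ENNReal.mul_ne_top hp (by simp))) (ha _ (ENNReal.mul_ne_top hp (by simp)))
  add_mem' ha hb p hp := (ha p hp).add (hb p hp)
  algebraMap_mem' c p _ := memLp_const c
  star_mem' ha p hp := (ha p hp).star

variable {P}

lemma integrable_coe_momentAlgebra (y : momentAlgebra P) : Integrable (y : Ω → ℂ) P :=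
  memLp_one_iff_integrable.1 (y.2 1 (by simp))

/-- The expectation as a linear functional. -/
def expect (P : Measure Ω) [IsProbabilityMeasure P] : momentAlgebra P →ₗ[ℂ] ℂ where
  toFun y := ∫ ω, (y : Ω → ℂ) ω ∂P
  map_add' y z := integral_add (integrable_coe_momentAlgebra y) (integrable_coe_momentAlgebra z)
  map_smul' c _ := integral_const_mul c _

lemma expect_apply (y : momentAlgebra P) : expect P y = ∫ ω, (y : Ω → ℂ) ω ∂P := rfl

lemma expect_one : expect P 1 = 1 := by
  change ∫ _, (1 : ℂ) ∂P = 1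
  simp

lemma expect_star (y : momentAlgebra P) : expect P (star y) = conj (expect P y) := integral_conj

end MomentAlgebra

section GaussianMoments

lemma iteratedDeriv_succ_id_mul {f : ℝ → ℝ} {x : ℝ} {n : ℕ} (hf : ContDiffAt ℝ (n + 1 : ℕ) f x) :
    iteratedDeriv (n + 1) (id * f) x =
      x * iteratedDeriv (n + 1) f x + (n + 1) * iteratedDeriv n f x := by
  rw [iteratedDeriv_mul contDiffAt_id hf, Finset.sum_range_succ', Finset.sum_range_succ']
  simp [iteratedDeriv_id, add_comm]

lemma integral_pow_add_two_gaussianReal (v : NNReal) (n : ℕ) :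
    ∫ x, x ^ (n + 2) ∂gaussianReal 0 v = (n + 1) * v * ∫ x, x ^ n ∂gaussianReal 0 v := by
  have zero_mem : (0 : ℝ) ∈ interior (integrableExpSet id (gaussianReal 0 v)) := by
    simp [integrableExpSet_id_gaussianReal]
  have moment (m : ℕ) : iteratedDeriv m (mgf id (gaussianReal 0 v)) 0 =
      ∫ x, x ^ m ∂gaussianReal 0 v := iteratedDeriv_mgf_zero zero_mem m
  have smooth : ContDiffAt ℝ (n + 1 : ℕ) (mgf id (gaussianReal 0 v)) 0 :=
    (analyticAt_mgf zero_mem).contDiffAt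
  have deriv_mgf : deriv (mgf id (gaussianReal 0 v)) =
      (v : ℝ) • (id * mgf id (gaussianReal 0 v)) := by
    rw [mgf_id_gaussianReal]
    funext t
    have hexponent : HasDerivAt (fun t : ℝ => 0 * t + v * t ^ 2 / 2) (v * t) t := by
      simpa using (((hasDerivAt_pow 2 t).const_mul (v : ℝ)).div_const 2).congr_deriv (by
        push_cast; ring)
    simpa [mul_comm, mul_left_comm, mul_assoc] using hexponent.exp.deriv
  rw [← moment, ← moment, iteratedDeriv_succ', deriv_mgf, iteratedDeriv_const_smul_field,
    iteratedDeriv_succ_id_mul smooth]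
  simp only [zero_mul, zero_add, smul_eq_mul]
  ring

variable {Ω : Type*} [MeasurableSpace Ω] {P : Measure Ω} {E : Type*} [NormedAddCommGroup E]
  [NormedSpace ℝ E]

lemma integral_pow_of_hasGaussianLaw {Y : Ω → ℝ} (hY : HasGaussianLaw Y P)
    (h0 : ∫ ω, Y ω ∂P = 0) (n : ℕ) :
    ∫ ω, Y ω ^ (n + 2) ∂P = (n + 1) * (∫ ω, Y ω ^ 2 ∂P) * ∫ ω, Y ω ^ n ∂P := by
  have transfer (m : ℕ) : ∫ ω, Y ω ^ m ∂P = ∫ x, x ^ m ∂gaussianReal 0 Var[Y; P].toNNReal := by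
    rw [← h0, ← hY.map_eq_gaussianReal,
      integral_map hY.aemeasurable (continuous_pow m).aestronglyMeasurable]
  have hvar : ∫ x, x ^ 2 ∂gaussianReal 0 Var[Y; P].toNNReal = Var[Y; P].toNNReal := by
    simpa using integral_pow_add_two_gaussianReal Var[Y; P].toNNReal 0
  rw [transfer, transfer, transfer, hvar, integral_pow_add_two_gaussianReal]

variable [IsProbabilityMeasure P]

/-- The random variables that are real-valued linear forms in the random vector `X`. -/
def realForms (P : Measure Ω) [IsProbabilityMeasure P] (X : Ω → E) :
    AddSubgroup (momentAlgebra P) where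
  carrier := {y | ∃ T : E →L[ℝ] ℝ, ∀ ω, (y : Ω → ℂ) ω = T (X ω)}
  add_mem' := by
    rintro y z ⟨T, hT⟩ ⟨U, hU⟩
    exact ⟨T + U, fun ω => by simp [← hT, ← hU]⟩
  zero_mem' := ⟨0, fun ω => by simp⟩
  neg_mem' := by
    rintro y ⟨T, hT⟩
    exact ⟨-T, fun ω => by simp [← hT]⟩

/-- The random variables that are real-linear, complex-valued forms in the random vector `X`. -/
def linearForms (P : Measure Ω) [IsProbabilityMeasure P] (X : Ω → E) :
    Submodule ℂ (momentAlgebra P) where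
  carrier := {y | ∃ T : E →L[ℝ] ℂ, ∀ ω, (y : Ω → ℂ) ω = T (X ω)}
  add_mem' := by
    rintro y z ⟨T, hT⟩ ⟨U, hU⟩
    exact ⟨T + U, fun ω => by simp [← hT, ← hU]⟩
  zero_mem' := ⟨0, fun ω => by simp⟩
  smul_mem' := by
    rintro c y ⟨T, hT⟩
    exact ⟨c • T, fun ω => by simp [← hT]⟩

variable {X : Ω → E}

lemma star_mem_linearForms {y : momentAlgebra P} (hy : y ∈ linearForms P X) :
    star y ∈ linearForms P X := by
  obtain ⟨T, hT⟩ := hy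
  exact ⟨Complex.conjCLE.toContinuousLinearMap.comp T, fun ω => by simp [← hT]⟩

variable [MeasurableSpace E] [BorelSpace E]

lemma exists_mem_realForms (hX : HasGaussianLaw X P) (T : E →L[ℝ] ℝ) :
    ∃ y ∈ realForms P X, ∀ ω, (y : Ω → ℂ) ω = T (X ω) :=
  ⟨⟨fun ω => T (X ω), fun _ hp => ((hX.map_fun T).memLp hp).ofReal⟩, ⟨T, fun _ => rfl⟩,
    fun _ => rfl⟩

lemma exists_add_smul_I_of_mem_linearForms (hX : HasGaussianLaw X P) {y : momentAlgebra P}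
    (hy : y ∈ linearForms P X) :
    ∃ a ∈ realForms P X, ∃ b ∈ realForms P X, y = a + Complex.I • b := by
  obtain ⟨T, hT⟩ := hy
  obtain ⟨a, ha, ha_apply⟩ := exists_mem_realForms hX (Complex.reCLM.comp T)
  obtain ⟨b, hb, hb_apply⟩ := exists_mem_realForms hX (Complex.imCLM.comp T)
  refine ⟨a, ha, b, hb, Subtype.ext (funext fun ω => ?_)⟩
  simp [hT, ha_apply, hb_apply, mul_comm Complex.I, Complex.re_add_im]

variable [CompleteSpace E] [SecondCountableTopology E]

lemma hasGaussianMoments_realForms (hX : HasGaussianLaw X P) (h0 : ∫ ω, X ω ∂P = 0) :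
    HasGaussianMoments (expect P) (realForms P X) := by
  have moment {y : momentAlgebra P} {T : E →L[ℝ] ℝ} (hT : ∀ ω, (y : Ω → ℂ) ω = T (X ω)) (n : ℕ) :
      expect P (y ^ n) = (∫ ω, T (X ω) ^ n ∂P : ℝ) := by
    rw [expect_apply, ← integral_complex_ofReal]
    simp [hT]
  have mean_zero (T : E →L[ℝ] ℝ) : ∫ ω, T (X ω) ∂P = 0 := by
    rw [T.integral_comp_comm hX.integrable, h0, map_zero]
  have recursion (T : E →L[ℝ] ℝ) (n : ℕ) :=
    integral_pow_of_hasGaussianLaw (hX.map_fun T) (mean_zero T) n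
  constructor
  · rintro y ⟨T, hT⟩
    simpa [mean_zero T] using moment hT 1
  · rintro y ⟨T, hT⟩
    rw [moment hT, recursion T 1]
    simp [mean_zero T]
  · rintro y ⟨T, hT⟩
    rw [moment hT, moment hT, recursion T 2]
    push_cast
    ring

lemma hasGaussianMoments_linearForms (hX : HasGaussianLaw X P) (h0 : ∫ ω, X ω ∂P = 0) :
    HasGaussianMoments (expect P) (linearForms P X).toAddSubgroup :=
  (hasGaussianMoments_realForms hX h0).of_forall_exists_add_smul Complex.I
    fun _ hy => exists_add_smul_I_of_mem_linearForms hX hy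

end GaussianMoments

section CrossMoment

variable {Ω : Type*} [MeasurableSpace Ω] {P : Measure Ω} [IsProbabilityMeasure P]
  {m n o : Type*}

/-- The matrix `E[y zᴴ]` of mixed second moments of two random vectors. -/
def crossMoment (P : Measure Ω) [IsProbabilityMeasure P] :
    (m → momentAlgebra P) →ₗ[ℂ] (n → momentAlgebra P) →ₗ⋆[ℂ] Matrix m n ℂ :=
  LinearMap.mk₂'ₛₗ (RingHom.id ℂ) (starRingEnd ℂ)
    (fun y z => Matrix.of fun i j => expect P (y i * star (z j)))
    (fun _ _ _ => by ext; simp [add_mul]) (fun _ _ _ => by ext; simp)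
    (fun _ _ _ => by ext; simp [mul_add]) (fun _ _ _ => by ext; simp)

lemma crossMoment_apply (y : m → momentAlgebra P) (z : n → momentAlgebra P) (i : m) (j : n) :
    crossMoment P y z i j = expect P (y i * star (z j)) := rfl

lemma crossMoment_conjTranspose (y : m → momentAlgebra P) (z : n → momentAlgebra P) :
    (crossMoment P y z)ᴴ = crossMoment P z y := by
  ext i j
  simp [crossMoment_apply, ← expect_star, mul_comm]

lemma crossMoment_star_star (y : m → momentAlgebra P) (z : n → momentAlgebra P) :
    crossMoment P (star y) (star z) = (crossMoment P z y)ᵀ := by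
  ext i j
  simp [crossMoment_apply, mul_comm]

/-- The image of a random vector under a deterministic matrix. -/
def linearImage [Fintype n] (A : Matrix m n ℂ) (y : n → momentAlgebra P) : m → momentAlgebra P :=
  fun i => ∑ j, A i j • y j

lemma linearImage_mem [Fintype n] {S : Submodule ℂ (momentAlgebra P)} (A : Matrix m n ℂ)
    {y : n → momentAlgebra P} (hy : ∀ j, y j ∈ S) (i : m) : linearImage A y i ∈ S :=
  sum_mem fun j _ => S.smul_mem _ (hy j)

lemma crossMoment_linearImage_left [Fintype n] (A : Matrix m n ℂ) (y : n → momentAlgebra P)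
    (z : o → momentAlgebra P) :
    crossMoment P (linearImage A y) z = A * crossMoment P y z := by
  ext i j
  simp [crossMoment_apply, linearImage, mul_apply, Finset.sum_mul]

lemma crossMoment_linearImage_right [Fintype n] (A : Matrix m n ℂ) (y : o → momentAlgebra P)
    (z : n → momentAlgebra P) :
    crossMoment P y (linearImage A z) = crossMoment P y z * Aᴴ := by
  rw [← crossMoment_conjTranspose, crossMoment_linearImage_left, conjTranspose_mul,
    crossMoment_conjTranspose]

/-- The random vector that is constantly `a`. -/
def constVec (P : Measure Ω) [IsProbabilityMeasure P] (a : m → ℂ) : m → momentAlgebra P :=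
  fun i => algebraMap ℂ _ (a i)

lemma star_constVec (a : m → ℂ) : star (constVec P a) = constVec P (star a) :=
  funext fun i => (algebraMap_star_comm (a i)).symm

lemma expect_constVec_add_mul_constVec_add (a b : ℂ) {y z : momentAlgebra P}
    (hy : expect P y = 0) (hz : expect P z = 0) :
    expect P ((algebraMap ℂ _ a + y) * (algebraMap ℂ _ b + z)) = a * b + expect P (y * z) := by
  have expand : (algebraMap ℂ _ a + y) * (algebraMap ℂ _ b + z) =
      (a * b) • (1 : momentAlgebra P) + a • z + b • y + y * z := by
    simp only [Algebra.smul_def, map_mul]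
    ring
  simp [expand, expect_one, hy, hz]

lemma crossMoment_constVec_add {a : m → ℂ} {b : n → ℂ} {y : m → momentAlgebra P}
    {z : n → momentAlgebra P} (hy : ∀ i, expect P (y i) = 0) (hz : ∀ j, expect P (z j) = 0) :
    crossMoment P (constVec P a + y) (constVec P b + z) =
      vecMulVec a (star b) + crossMoment P y z := by
  ext i j
  have hz' : expect P (star (z j)) = 0 := by rw [expect_star, hz, map_zero]
  rw [crossMoment_apply, Pi.add_apply, Pi.add_apply, star_add]
  exact (congrArg (fun c => expect P (_ * (c + _))) (algebraMap_star_comm (b j)).symm).trans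
    (expect_constVec_add_mul_constVec_add _ _ (hy i) hz')

end CrossMoment

section Realization

variable {Ω : Type*} [MeasurableSpace Ω] {P : Measure Ω} [IsProbabilityMeasure P] {m n : Type*}

/-- The value of a random vector at `ω`. -/
def realization (y : m → momentAlgebra P) (ω : Ω) : m → ℂ := fun i => (y i : Ω → ℂ) ω

lemma expOuter_realization (y : m → momentAlgebra P) :
    expOuter P (realization y) = crossMoment P y y := rfl

lemma realization_constVec_add (a : m → ℂ) (y : m → momentAlgebra P) (ω : Ω) :
    realization (constVec P a + y) ω = a + realization y ω := rfl

lemma realization_add (y z : m → momentAlgebra P) (ω : Ω) :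
    realization (y + z) ω = realization y ω + realization z ω := rfl

lemma realization_smul (c : ℂ) (y : m → momentAlgebra P) (ω : Ω) :
    realization (c • y) ω = c • realization y ω := rfl

lemma realization_sum {ι : Type*} (s : Finset ι) (y : ι → m → momentAlgebra P) (ω : Ω) :
    realization (∑ i ∈ s, y i) ω = ∑ i ∈ s, realization (y i) ω := by
  ext a
  simp [realization]

variable [Fintype n]

lemma realization_linearImage (A : Matrix m n ℂ) (y : n → momentAlgebra P) (ω : Ω) :
    realization (linearImage A y) ω = A *ᵥ realization y ω := by
  ext i
  simp [realization, linearImage, mulVec, dotProduct]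

lemma coe_dotProduct (y z : n → momentAlgebra P) (ω : Ω) :
    ((y ⬝ᵥ z : momentAlgebra P) : Ω → ℂ) ω = realization y ω ⬝ᵥ realization z ω := by
  simp [realization, dotProduct]

lemma integral_norm_sq_star_dotProduct (a : n → ℂ) (y : n → momentAlgebra P) :
    ∫ ω, ‖star a ⬝ᵥ realization y ω‖ ^ 2 ∂P = (star a ⬝ᵥ (crossMoment P y y *ᵥ a)).re := by
  let A : Matrix Unit n ℂ := replicateRow Unit (star a)
  let u : momentAlgebra P := linearImage A y ()
  have coe_u (ω : Ω) : (u : Ω → ℂ) ω = star a ⬝ᵥ realization y ω :=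
    congrFun (realization_linearImage A y ω) ()
  have expect_u : expect P (u * star u) = star a ⬝ᵥ (crossMoment P y y *ᵥ a) := by
    have hA : Aᴴ = replicateCol Unit a := by rw [conjTranspose_replicateRow, star_star]
    rw [← crossMoment_apply, crossMoment_linearImage_left, crossMoment_linearImage_right, hA,
      ← replicateCol_mulVec]
    rfl
  rw [← expect_u, expect_apply, ← Complex.ofReal_re (∫ ω, _ ∂P), ← integral_complex_ofReal]
  congr 2
  ext ω
  rw [← coe_u, Complex.ofReal_pow, ← Complex.mul_conj']
  rfl

end Realization

section GaussianInnerProduct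

variable {Ω : Type*} [MeasurableSpace Ω] {P : Measure Ω} [IsProbabilityMeasure P]
  {m n : Type*} [Fintype m] [Fintype n]

lemma star_constVec_add_dotProduct (a b : m → ℂ) (y w : m → momentAlgebra P) :
    star (constVec P a + y) ⬝ᵥ (constVec P b + w) =
      ∑ i, (algebraMap ℂ _ (conj (a i)) + star (y i)) * (algebraMap ℂ _ (b i) + w i) := by
  rw [star_add, star_constVec]
  rfl

lemma expect_star_dotProduct_constVec_add {a b : m → ℂ} {y w : m → momentAlgebra P}
    (hy : ∀ i, expect P (y i) = 0) (hw : ∀ i, expect P (w i) = 0) :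
    expect P (star (constVec P a + y) ⬝ᵥ (constVec P b + w)) =
      star a ⬝ᵥ b + trace (crossMoment P w y) := by
  have hy' (i : m) : expect P (star (y i)) = 0 := by rw [expect_star, hy, map_zero]
  rw [star_constVec_add_dotProduct]
  simp only [dotProduct, map_sum, trace, diag, crossMoment_apply,
    ← Finset.sum_add_distrib, mul_comm (w _)]
  exact Finset.sum_congr rfl fun i _ => expect_constVec_add_mul_constVec_add _ _ (hy' i) (hw i)

lemma expect_star_dotProduct_mul_star_star_dotProduct {S : AddSubgroup (momentAlgebra P)}
    (hS : HasGaussianMoments (expect P) S) (hS_star : ∀ y ∈ S, star y ∈ S)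
    {a b : m → ℂ} {a' b' : n → ℂ} {y w : m → momentAlgebra P} {y' w' : n → momentAlgebra P}
    (hy : ∀ i, y i ∈ S) (hw : ∀ i, w i ∈ S) (hy' : ∀ j, y' j ∈ S) (hw' : ∀ j, w' j ∈ S)
    (hyw' : crossMoment P y (star w') = 0) (hwy' : crossMoment P w (star y') = 0) :
    expect P ((star (constVec P a + y) ⬝ᵥ (constVec P b + w)) *
        star (star (constVec P a' + y') ⬝ᵥ (constVec P b' + w'))) =
      expect P (star (constVec P a + y) ⬝ᵥ (constVec P b + w)) *
          conj (expect P (star (constVec P a' + y') ⬝ᵥ (constVec P b' + w'))) +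
        (star a ⬝ᵥ (crossMoment P w w' *ᵥ a') + star b' ⬝ᵥ (crossMoment P y' y *ᵥ b) +
          trace (crossMoment P w w' * crossMoment P y' y)) := by
  have pseudo_left (i : m) (j : n) : expect P (star (y i) * star (w' j)) = 0 := by
    have h0 := congrArg conj (congrFun (congrFun hyw' i) j)
    simpa [crossMoment_apply, ← expect_star, mul_comm] using h0
  have pseudo_right (i : m) (j : n) : expect P (w i * y' j) = 0 := by
    simpa [crossMoment_apply] using congrFun (congrFun hwy' i) j
  have entry (i : m) (j : n) := hS.map_add_mul_add_mul_add_mul_add expect_one (hS_star _ (hy i))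
    (hw i) (hS_star _ (hw' j)) (hy' j) (conj (a i)) (b i) (conj (b' j)) (a' j)
  simp only [pseudo_left, pseudo_right, mul_zero, add_zero] at entry
  have star_inner : star (star (constVec P a' + y') ⬝ᵥ (constVec P b' + w')) =
      star (constVec P b' + w') ⬝ᵥ (constVec P a' + y') := by
    rw [star_dotProduct, star_star]
  rw [← expect_star, star_inner, star_constVec_add_dotProduct, star_constVec_add_dotProduct,
    Finset.sum_mul_sum, map_sum, map_sum, map_sum, Finset.sum_mul_sum]
  simp only [map_sum, entry, Finset.sum_add_distrib, add_right_inj]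
  congr 1
  · congr 1
    · simp only [dotProduct, mulVec, crossMoment_apply, Finset.mul_sum, Pi.star_apply,
        RCLike.star_def]
      exact Finset.sum_congr rfl fun i _ => Finset.sum_congr rfl fun j _ => by ring
    · simp only [dotProduct, mulVec, crossMoment_apply, Finset.mul_sum, Pi.star_apply,
        RCLike.star_def]
      rw [Finset.sum_comm]
      exact Finset.sum_congr rfl fun i _ => Finset.sum_congr rfl fun j _ => by
        rw [mul_comm (y' i)]; ring
  · simp only [trace, diag, mul_apply, crossMoment_apply]
    exact Finset.sum_congr rfl fun i _ => Finset.sum_congr rfl fun j _ => by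
      rw [mul_comm (y' j), mul_comm]

end GaussianInnerProduct

section Independence

variable {Ω : Type*} [MeasurableSpace Ω] {P : Measure Ω} [IsProbabilityMeasure P]
  {ι : Type*} {E : ι → Type*} [∀ i, MeasurableSpace (E i)]

/-- The random variables that are measurable functions of the `X i` with `i ∈ S`. -/
def dependsOn (P : Measure Ω) [IsProbabilityMeasure P] (X : ∀ i, Ω → E i) (S : Finset ι) :
    StarSubalgebra ℂ (momentAlgebra P) where
  carrier := {y | Measurable[MeasurableSpace.comap (fun ω (i : S) => X i ω) inferInstance]
    (y : Ω → ℂ)}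
  mul_mem' ha hb := ha.mul hb
  add_mem' ha hb := ha.add hb
  algebraMap_mem' _ := measurable_const
  star_mem' ha := Complex.continuous_conj.measurable.comp ha

variable {X : ∀ i, Ω → E i} {S T : Finset ι}

lemma mem_dependsOn {i : ι} (hi : i ∈ S) {f : E i → ℂ} (hf : Measurable f) {y : momentAlgebra P}
    (hy : ∀ ω, (y : Ω → ℂ) ω = f (X i ω)) : y ∈ dependsOn P X S := by
  have hg : Measurable fun x : (j : S) → E j => f (x ⟨i, hi⟩) := hf.comp (measurable_pi_apply _)
  have factor : (y : Ω → ℂ) =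
      (fun x : (j : S) → E j => f (x ⟨i, hi⟩)) ∘ fun ω (j : S) => X j ω := funext hy
  change Measurable[MeasurableSpace.comap (fun ω (i : S) => X i ω) inferInstance] (y : Ω → ℂ)
  rw [factor]
  exact hg.comp (comap_measurable _)

lemma expect_mul_of_dependsOn (hX : iIndepFun X P) (hm : ∀ i, AEMeasurable (X i) P)
    (hST : Disjoint S T) {y z : momentAlgebra P} (hy : y ∈ dependsOn P X S)
    (hz : z ∈ dependsOn P X T) : expect P (y * z) = expect P y * expect P z := by
  have hindep := hX.indepFun_finset₀ S T hST hm
  rw [IndepFun_iff_Indep] at hindep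
  have hyz : IndepFun (y : Ω → ℂ) (z : Ω → ℂ) P := by
    rw [IndepFun_iff_Indep]
    exact indep_of_indep_of_le_left (indep_of_indep_of_le_right hindep hz.comap_le) hy.comap_le
  exact hyz.integral_mul_eq_mul_integral (integrable_coe_momentAlgebra y).aestronglyMeasurable
    (integrable_coe_momentAlgebra z).aestronglyMeasurable

variable {m n : Type*} [Fintype m] [Fintype n]

lemma expect_dotProduct_mul_star_dotProduct (hX : iIndepFun X P) (hm : ∀ i, AEMeasurable (X i) P)
    (hST : Disjoint S T) {t u : m → momentAlgebra P} {t' u' : n → momentAlgebra P}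
    (ht : ∀ i, t i ∈ dependsOn P X S) (ht' : ∀ j, t' j ∈ dependsOn P X S)
    (hu : ∀ i, u i ∈ dependsOn P X T) (hu' : ∀ j, u' j ∈ dependsOn P X T) :
    expect P ((t ⬝ᵥ u) * star (t' ⬝ᵥ u')) =
      trace (crossMoment P u u' * (crossMoment P t t')ᵀ) := by
  have factor (i : m) (j : n) : expect P (t i * u i * star (t' j * u' j)) =
      expect P (u i * star (u' j)) * expect P (t i * star (t' j)) := by
    rw [star_mul', mul_mul_mul_comm, expect_mul_of_dependsOn hX hm hST
      (mul_mem (ht i) (star_mem (ht' j))) (mul_mem (hu i) (star_mem (hu' j))), mul_comm]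
  simp only [dotProduct, star_sum, Finset.sum_mul_sum, map_sum, factor]
  rfl

lemma expect_add_dotProduct_mul_star_add_dotProduct (hX : iIndepFun X P)
    (hm : ∀ i, AEMeasurable (X i) P) (hST : Disjoint S T)
    {t t' u : m → momentAlgebra P} {s s' q q' : n → momentAlgebra P}
    (ht : ∀ i, t i ∈ dependsOn P X S) (ht' : ∀ i, t' i ∈ dependsOn P X S)
    (hs : ∀ j, s j ∈ dependsOn P X S) (hs' : ∀ j, s' j ∈ dependsOn P X S)
    (hu : ∀ i, u i ∈ dependsOn P X T) (hq : ∀ j, q j ∈ dependsOn P X T)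
    (hq' : ∀ j, q' j ∈ dependsOn P X T)
    (huq' : crossMoment P u q' = 0) (hqu : crossMoment P q u = 0) :
    expect P ((t ⬝ᵥ u + s ⬝ᵥ q) * star (t' ⬝ᵥ u + s' ⬝ᵥ q')) =
      trace (crossMoment P u u * (crossMoment P t t')ᵀ) +
        trace (crossMoment P q q' * (crossMoment P s s')ᵀ) := by
  rw [star_add, add_mul, mul_add, mul_add]
  simp only [map_add, expect_dotProduct_mul_star_dotProduct hX hm hST ht ht' hu hu,
    expect_dotProduct_mul_star_dotProduct hX hm hST ht hs' hu hq',
    expect_dotProduct_mul_star_dotProduct hX hm hST hs ht' hq hu,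
    expect_dotProduct_mul_star_dotProduct hX hm hST hs hs' hq hq', huq', hqu, Matrix.zero_mul,
    trace_zero, add_zero, zero_add]

end Independence

section CNFamily

variable {Ω : Type*} [MeasurableSpace Ω] {P : Measure Ω} {ι : Type*} {d : ι → ℕ}
  {X : ∀ i, Ω → Fin (d i) → ℂ}

/-- The family `X` consists of independent centred circularly symmetric complex Gaussian random
vectors. -/
structure IsCNFamily (P : Measure Ω) (X : ∀ i, Ω → Fin (d i) → ℂ) : Prop where
  indep : iIndepFun X P
  exists_isCN : ∀ i, ∃ C, IsCN P (X i) 0 C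

lemma IsCNFamily.hasGaussianLaw (hX : IsCNFamily P X) (i : ι) : HasGaussianLaw (X i) P :=
  (hX.exists_isCN i).choose_spec.gaussian

variable [IsProbabilityMeasure P]

/-- The entries of a Gaussian random vector. -/
def gaussianVec {n : Type*} [Fintype n] {Y : Ω → n → ℂ} (hY : HasGaussianLaw Y P) :
    n → momentAlgebra P := fun a =>
  ⟨fun ω => Y ω a, fun _ hp =>
    (hY.map_fun (ContinuousLinearMap.proj (R := ℝ) (φ := fun _ => ℂ) a)).memLp hp⟩

/-- The entries of the random vector `X i`. -/
def IsCNFamily.vec (hX : IsCNFamily P X) (i : ι) : Fin (d i) → momentAlgebra P :=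
  gaussianVec (hX.hasGaussianLaw i)

namespace IsCN

variable {n : ℕ} {Y : Ω → Fin n → ℂ} {C : Matrix (Fin n) (Fin n) ℂ}

lemma crossMoment_gaussianVec_self (hY : IsCN P Y 0 C) :
    crossMoment P (gaussianVec hY.gaussian) (gaussianVec hY.gaussian) = C := by
  ext a b
  have hcov := hY.cov a b
  simp only [Pi.zero_apply, sub_zero] at hcov
  exact hcov

lemma expect_gaussianVec_mul_gaussianVec (hY : IsCN P Y 0 C) (a b : Fin n) :
    expect P (gaussianVec hY.gaussian a * gaussianVec hY.gaussian b) = 0 := by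
  have hcov := hY.pseudoCov a b
  simp only [Pi.zero_apply, sub_zero] at hcov
  exact hcov

end IsCN

variable {S T : Finset ι} {y z : momentAlgebra P}

/-- The complex linear combinations of the entries of the random vectors `X i` with `i ∈ S`. -/
def coordSpan (P : Measure Ω) [IsProbabilityMeasure P] (X : ∀ i, Ω → Fin (d i) → ℂ)
    (S : Finset ι) : Submodule ℂ (momentAlgebra P) :=
  Submodule.span ℂ {y | ∃ i ∈ S, ∃ a, ∀ ω, (y : Ω → ℂ) ω = X i ω a}

lemma IsCNFamily.vec_mem_coordSpan (hX : IsCNFamily P X) {i : ι} (hi : i ∈ S) (a : Fin (d i)) :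
    hX.vec i a ∈ coordSpan P X S :=
  Submodule.subset_span ⟨i, hi, a, fun _ => rfl⟩

lemma mem_dependsOn_of_mem_coordSpan (hy : y ∈ coordSpan P X S) : y ∈ dependsOn P X S := by
  have hle : coordSpan P X S ≤ Subalgebra.toSubmodule (dependsOn P X S).toSubalgebra :=
    Submodule.span_le.2 fun _ ⟨_, hi, a, hy⟩ => mem_dependsOn hi (measurable_pi_apply a) hy
  exact hle hy

lemma coordSpan_le_linearForms [Fintype ι] :
    coordSpan P X S ≤ linearForms P fun ω i => X i ω :=
  Submodule.span_le.2 fun _ ⟨i, _, a, hy⟩ =>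
    ⟨(ContinuousLinearMap.proj (R := ℝ) (φ := fun _ : Fin (d i) => ℂ) a).comp
      (ContinuousLinearMap.proj (R := ℝ) (φ := fun i => Fin (d i) → ℂ) i), hy⟩

namespace IsCNFamily

lemma expect_vec (hX : IsCNFamily P X) (i : ι) (a : Fin (d i)) :
    expect P (hX.vec i a) = 0 :=
  (hX.exists_isCN i).choose_spec.mean a

lemma expect_mul_of_disjoint (hX : IsCNFamily P X) (hST : Disjoint S T)
    (hy : y ∈ dependsOn P X S) (hz : z ∈ dependsOn P X T) :
    expect P (y * z) = expect P y * expect P z :=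
  expect_mul_of_dependsOn hX.indep (fun i => (hX.hasGaussianLaw i).aemeasurable) hST hy hz

lemma expect_eq_zero (hX : IsCNFamily P X) (hy : y ∈ coordSpan P X S) : expect P y = 0 := by
  have hle : coordSpan P X S ≤ LinearMap.ker (expect P) :=
    Submodule.span_le.2 fun y ⟨i, _, a, hy⟩ => by
      obtain rfl : y = hX.vec i a := Subtype.ext (funext hy)
      exact hX.expect_vec i a
  exact hle hy

lemma expect_mul_eq_zero (hX : IsCNFamily P X) (hy : y ∈ coordSpan P X S)
    (hz : z ∈ coordSpan P X T) : expect P (y * z) = 0 := by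
  have coord_mul_coord (i j : ι) (a : Fin (d i)) (b : Fin (d j)) :
      expect P (hX.vec i a * hX.vec j b) = 0 := by
    by_cases hij : i = j
    · subst hij
      exact (hX.exists_isCN i).choose_spec.expect_gaussianVec_mul_gaussianVec a b
    · rw [hX.expect_mul_of_disjoint (Finset.disjoint_singleton.2 hij)
        (mem_dependsOn_of_mem_coordSpan (hX.vec_mem_coordSpan (Finset.mem_singleton_self i) a))
        (mem_dependsOn_of_mem_coordSpan (hX.vec_mem_coordSpan (Finset.mem_singleton_self j) b)),
        hX.expect_vec, zero_mul]
  induction hy, hz using Submodule.span_induction₂ with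
  | mem_mem y z hy hz =>
    obtain ⟨i, -, a, hy⟩ := hy
    obtain ⟨j, -, b, hz⟩ := hz
    obtain rfl : y = hX.vec i a := Subtype.ext (funext hy)
    obtain rfl : z = hX.vec j b := Subtype.ext (funext hz)
    exact coord_mul_coord i j a b
  | zero_left | zero_right => simp
  | add_left _ _ _ _ _ _ h₁ h₂ => rw [add_mul, map_add, h₁, h₂, add_zero]
  | add_right _ _ _ _ _ _ h₁ h₂ => rw [mul_add, map_add, h₁, h₂, add_zero]
  | smul_left c _ _ _ _ h => rw [smul_mul_assoc, map_smul, h, smul_zero]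
  | smul_right c _ _ _ _ h => rw [mul_smul_comm, map_smul, h, smul_zero]

variable {m n : Type*} {u : m → momentAlgebra P} {v : n → momentAlgebra P}

lemma crossMoment_eq_zero (hX : IsCNFamily P X) (hST : Disjoint S T)
    (hu : ∀ i, u i ∈ coordSpan P X S) (hv : ∀ j, v j ∈ coordSpan P X T) :
    crossMoment P u v = 0 := by
  ext i j
  rw [crossMoment_apply, hX.expect_mul_of_disjoint hST (mem_dependsOn_of_mem_coordSpan (hu i))
    (star_mem (mem_dependsOn_of_mem_coordSpan (hv j))), hX.expect_eq_zero (hu i), zero_mul]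
  rfl

lemma crossMoment_star_eq_zero (hX : IsCNFamily P X) (hu : ∀ i, u i ∈ coordSpan P X S)
    (hv : ∀ j, v j ∈ coordSpan P X T) : crossMoment P u (star v) = 0 := by
  ext i j
  simpa [crossMoment_apply] using hX.expect_mul_eq_zero (hu i) (hv j)

lemma crossMoment_vec_self (hX : IsCNFamily P X) {i : ι} {C : Matrix (Fin (d i)) (Fin (d i)) ℂ}
    (hC : IsCN P (X i) 0 C) : crossMoment P (hX.vec i) (hX.vec i) = C :=
  hC.crossMoment_gaussianVec_self

lemma crossMoment_vec_of_ne (hX : IsCNFamily P X) {i j : ι} (hij : i ≠ j) :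
    crossMoment P (hX.vec i) (hX.vec j) = 0 :=
  hX.crossMoment_eq_zero (Finset.disjoint_singleton.2 hij)
    (hX.vec_mem_coordSpan (Finset.mem_singleton_self i))
    (hX.vec_mem_coordSpan (Finset.mem_singleton_self j))

lemma expect_vec_mul_star_vec_of_ne (hX : IsCNFamily P X) {i j : ι} (hij : i ≠ j)
    (a : Fin (d i)) (b : Fin (d j)) : expect P (hX.vec i a * star (hX.vec j b)) = 0 :=
  congrFun₂ (hX.crossMoment_vec_of_ne hij) a b

lemma hasGaussianMoments [Fintype ι] (hX : IsCNFamily P X) :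
    HasGaussianMoments (expect P) (linearForms P fun ω i => X i ω).toAddSubgroup := by
  have joint : HasGaussianLaw (fun ω i => X i ω) P := hX.indep.hasGaussianLaw hX.hasGaussianLaw
  refine hasGaussianMoments_linearForms joint ?_
  ext i a
  let coord : (∀ i, Fin (d i) → ℂ) →L[ℝ] ℂ :=
    (ContinuousLinearMap.proj (R := ℝ) (φ := fun _ : Fin (d i) => ℂ) a).comp
      (ContinuousLinearMap.proj (R := ℝ) (φ := fun i => Fin (d i) → ℂ) i)
  exact (coord.integral_comp_comm joint.integrable).symm.trans (hX.expect_vec i a)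

end IsCNFamily

end CNFamily

namespace Network

variable {K L N τ : ℕ} (W : Network K L N τ)

lemma pdd_nonneg (i : Fin K) : 0 ≤ W.pdd i :=
  mul_nonneg (sub_nonneg.2 W.ρda_lt_one.le) (W.p_nonneg i)

lemma one_sub_ρda_pos : 0 < 1 - W.ρda := sub_pos.2 W.ρda_lt_one

lemma one_sub_ρad_pos : 0 < 1 - W.ρad := sub_pos.2 W.ρad_lt_one

section Pilots

lemma φ_mul_conj_φ [NeZero τ] (s t r : Fin τ) :
    W.φ s r * conj (W.φ t r) =
      ZMod.stdAddChar (((r : ℕ) : ZMod τ) * (((t : ℕ) : ZMod τ) - ((s : ℕ) : ZMod τ))) := by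
  have coe_char := ZMod.stdAddChar_coe (N := τ) (((r : ℕ) : ℤ) * (((t : ℕ) : ℤ) - ((s : ℕ) : ℤ)))
  push_cast at coe_char
  rw [coe_char, φ, φ, ← Complex.exp_conj, ← Complex.exp_add]
  congr 1
  simp only [map_div₀, map_mul, map_neg, Complex.conj_I, Complex.conj_ofReal, map_natCast,
    map_ofNat]
  ring

lemma sum_fin_natCast_zmod [NeZero τ] {M : Type*} [AddCommMonoid M] (f : ZMod τ → M) :
    ∑ r : Fin τ, f ((r : ℕ) : ZMod τ) = ∑ x, f x :=
  Fintype.sum_bijective (fun r : Fin τ => ((r : ℕ) : ZMod τ))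
    ⟨fun r s h =>
        Fin.ext (((ZMod.natCast_eq_natCast_iff _ _ _).1 h).eq_of_lt_of_lt r.2 s.2),
      fun x => ⟨⟨x.val, x.val_lt⟩, ZMod.natCast_zmod_val x⟩⟩ _ _ fun _ => rfl

lemma φ_dotProduct_star_φ (s t : Fin τ) :
    W.φ s ⬝ᵥ star (W.φ t) = if s = t then (τ : ℂ) else 0 := by
  have : NeZero τ := ⟨(Fin.pos s).ne'⟩
  let δ : ZMod τ := ((t : ℕ) : ZMod τ) - ((s : ℕ) : ZMod τ)
  have δ_eq_zero_iff : δ = 0 ↔ s = t := by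
    rw [sub_eq_zero, ZMod.natCast_eq_natCast_iff, Fin.ext_iff]
    exact ⟨fun h => (h.eq_of_lt_of_lt t.2 s.2).symm, fun h => h ▸ rfl⟩
  calc W.φ s ⬝ᵥ star (W.φ t)
      = ∑ r : Fin τ, ZMod.stdAddChar (((r : ℕ) : ZMod τ) * δ) :=
        Finset.sum_congr rfl fun r _ => W.φ_mul_conj_φ s t r
    _ = ∑ x, ZMod.stdAddChar (x * δ) := sum_fin_natCast_zmod fun x => ZMod.stdAddChar (x * δ)
    _ = if s = t then (τ : ℂ) else 0 := by
        simp [AddChar.sum_mulShift _ (ZMod.isPrimitive_stdAddChar τ), δ_eq_zero_iff]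

/-- The normalized pilot with which AP `l` correlates its received pilot matrix. -/
def correlator (k : Fin K) : Fin τ → ℂ := ((1 / Real.sqrt τ : ℝ) : ℂ) • star (W.φ (W.pilot k))

lemma φ_dotProduct_correlator (i k : Fin K) :
    W.φ (W.pilot i) ⬝ᵥ W.correlator k = if i ∈ W.PSet k then (Real.sqrt τ : ℂ) else 0 := by
  simp only [correlator, dotProduct_smul, φ_dotProduct_star_φ, PSet, Finset.mem_filter,
    Finset.mem_univ, true_and, smul_eq_mul, mul_ite, mul_zero]
  congr 1
  norm_cast
  rw [one_div, inv_mul_eq_div, Real.div_sqrt]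

lemma correlator_dotProduct_star_correlator (k : Fin K) :
    W.correlator k ⬝ᵥ star (W.correlator k) = 1 := by
  have hτ : (τ : ℝ) ≠ 0 := Nat.cast_ne_zero.2 (Fin.pos (W.pilot k)).ne'
  have sqrt_mul_sqrt : ((1 / Real.sqrt τ : ℝ) : ℂ) * (Real.sqrt τ : ℂ) = 1 := by
    norm_cast
    field_simp
  have hself := W.φ_dotProduct_correlator k k
  simp only [PSet, Finset.mem_filter, Finset.mem_univ, true_and, if_true] at hself
  nth_rewrite 2 [correlator]
  rw [star_smul, star_star, dotProduct_smul, dotProduct_comm, hself, smul_eq_mul, RCLike.star_def,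
    Complex.conj_ofReal, sqrt_mul_sqrt]

/-- Effective noise at AP `l` during the pilot symbol `t`: the column `t` of `N_l`. -/
def npilot {Ω : Type*} (_W : Network K L N τ) (X : Sources K L N τ Ω) (l : Fin L) (t : Fin τ) :
    Ω → Fin N → ℂ := X (.pilotNoise l t)

lemma z_eq {Ω : Type*} (X : Sources K L N τ Ω) (k : Fin K) (l : Fin L) (ω : Ω) :
    W.z X k l ω =
      ((1 - W.ρad : ℝ) : ℂ) • ∑ i ∈ W.PSet k, (Real.sqrt (W.pdd i * τ) : ℂ) • W.h X i l ω +
        ∑ t, W.correlator k t • W.npilot X l t ω := by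
  have pilot_part (i : Fin K) : vecMulVec (W.h X i l ω) (W.φ (W.pilot i)) *ᵥ W.correlator k =
      (if i ∈ W.PSet k then (Real.sqrt τ : ℂ) else 0) • W.h X i l ω := by
    rw [vecMulVec_mulVec, φ_dotProduct_correlator, op_smul_eq_smul]
  have noise_part : (Matrix.of fun n t => W.npilot X l t ω n) *ᵥ W.correlator k =
      ∑ t, W.correlator k t • W.npilot X l t ω := by
    ext n
    simp only [mulVec, dotProduct, Matrix.of_apply, Finset.sum_apply, Pi.smul_apply, smul_eq_mul,
      mul_comm]
  have z_eq_mulVec : W.z X k l ω = W.Z X l ω *ᵥ W.correlator k := (mulVec_smul _ _ _).symm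
  rw [z_eq_mulVec, ← noise_part, Z, add_mulVec, smul_mulVec, sum_mulVec]
  refine congrArg (· + _) ?_
  simp only [smul_mulVec, pilot_part, ite_smul, zero_smul, smul_ite, smul_zero, Finset.sum_ite_mem,
    Finset.univ_inter, smul_smul, Real.sqrt_mul (W.pdd_nonneg _), Complex.ofReal_mul]

lemma zw_eq {Ω : Type*} (X : Sources K L N τ Ω) (k : Fin K) (l : Fin L) (ω : Ω) :
    W.zw X k l ω =
      ((1 - W.ρad : ℝ) : ℂ) • ∑ i ∈ W.PSet k, (Real.sqrt (W.pdd i * τ) : ℂ) • W.hw X i l ω +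
        ∑ t, W.correlator k t • W.npilot X l t ω := by
  simp only [zw, z_eq, h, smul_add, Finset.sum_add_distrib]
  abel

end Pilots

section Positivity

/-- Covariance matrix of the receiver and ADC noise at AP `l` in the data phase. -/
def rxCov (l : Fin L) : Matrix (Fin N) (Fin N) ℂ :=
  ((W.ρad * (1 - W.ρad) / (1 - W.ρda) : ℝ) : ℂ) • diagonal (diag (W.S l)) +
    (((1 - W.ρad) * W.σsq : ℝ) : ℂ) • 1

lemma S_posSemidef (l : Fin L) : (W.S l).PosSemidef :=
  posSemidef_sum _ fun i _ => ((posSemidef_vecMulVec_self_star _).add (W.R_psd i l)).smul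
    (by exact_mod_cast W.pdd_nonneg i)

lemma rxCov_posDef (l : Fin L) : (W.rxCov l).PosDef := by
  have hda := W.one_sub_ρda_pos
  have had := W.one_sub_ρad_pos
  have hρ := W.ρad_nonneg
  have hσ := W.σsq_pos
  refine PosDef.posSemidef_add (PosSemidef.smul
    (posSemidef_diagonal_iff.2 fun _ => (W.S_posSemidef l).diag_nonneg) ?_) (PosDef.one.smul ?_)
  · exact Complex.zero_le_real.2 (by positivity)
  · exact Complex.zero_lt_real.2 (by positivity)

lemma Cn_posDef (l : Fin L) : (W.Cn l).PosDef := by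
  have hda := W.one_sub_ρda_pos
  have hρ := W.ρda_nonneg
  rw [Cn, add_assoc]
  exact PosDef.posSemidef_add ((W.S_posSemidef l).smul (Complex.zero_le_real.2 (by positivity)))
    (W.rxCov_posDef l)

lemma Psi_posDef (k : Fin K) (l : Fin L) : (W.Psi k l).PosDef := by
  refine PosDef.posSemidef_add (PosSemidef.smul (posSemidef_sum _ fun i _ =>
    (W.R_psd i l).smul ?_) (Complex.zero_le_real.2 (sq_nonneg _))) (W.Cn_posDef l)
  exact Complex.zero_le_real.2 (mul_nonneg (W.pdd_nonneg i) (Nat.cast_nonneg _))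

lemma isUnit_det_Psi (k : Fin K) (l : Fin L) : IsUnit (W.Psi k l).det :=
  (isUnit_iff_isUnit_det _).1 (W.Psi_posDef k l).isUnit

end Positivity

end Network

section PosSemidef

variable {n : Type*} [Fintype n] {A B : Matrix n n ℂ}

open scoped MatrixOrder in
lemma trace_mul_nonneg (hA : A.PosSemidef) (hB : B.PosSemidef) : 0 ≤ trace (A * B) := by
  classical
  obtain ⟨S, rfl⟩ := CStarAlgebra.nonneg_iff_eq_star_mul_self.mp hB.nonneg
  rw [star_eq_conjTranspose, ← mul_assoc, trace_mul_comm, ← mul_assoc]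
  exact (hA.mul_mul_conjTranspose_same S).trace_nonneg

lemma eq_zero_of_conjTranspose_mul_mul_eq_zero (hA : A.PosDef) (h : Bᴴ * A * B = 0) : B = 0 := by
  classical
  have mulVec_eq_zero (v : n → ℂ) : B *ᵥ v = 0 := by
    by_contra hv
    have hpos := hA.dotProduct_mulVec_pos hv
    rw [star_mulVec, ← dotProduct_mulVec, mulVec_mulVec, mulVec_mulVec, mul_assoc, ← mul_assoc,
      h, zero_mulVec, dotProduct_zero] at hpos
    exact lt_irrefl _ hpos
  exact Matrix.ext_of_mulVec_single fun a => by rw [mulVec_eq_zero, zero_mulVec]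

end PosSemidef

namespace Network

section ClosedForms

variable {K L N τ : ℕ} (W : Network K L N τ)

/-- The matrix that maps the centred correlated pilot signal to the MMSE estimate of `h_{w,kl}`. -/
def estimator (k : Fin K) (l : Fin L) : Matrix (Fin N) (Fin N) ℂ :=
  (((1 - W.ρad) * Real.sqrt (W.pdd k * τ) : ℝ) : ℂ) • (W.R k l * (W.Psi k l)⁻¹)

lemma conjTranspose_estimator (k : Fin K) (l : Fin L) :
    (W.estimator k l)ᴴ =
      (((1 - W.ρad) * Real.sqrt (W.pdd k * τ) : ℝ) : ℂ) • ((W.Psi k l)⁻¹ * W.R k l) := by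
  rw [estimator, conjTranspose_smul, conjTranspose_mul, (W.R_psd k l).isHermitian.eq,
    (W.Psi_posDef k l).inv.isHermitian.eq, RCLike.star_def, Complex.conj_ofReal]

/-- Covariance matrix of the MMSE estimate `ĥ_{kl}`. -/
def estCov (k : Fin K) (l : Fin L) : Matrix (Fin N) (Fin N) ℂ :=
  (((1 - W.ρad) ^ 2 * τ * W.pdd k : ℝ) : ℂ) • (W.R k l * (W.Psi k l)⁻¹ * W.R k l)

/-- The matrix `E[ĥ_{kl} ĥ_{kl}ᴴ]` of second moments of the MMSE estimate. -/
def estMoment (k : Fin K) (l : Fin L) : Matrix (Fin N) (Fin N) ℂ :=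
  vecMulVec (W.hbar k l) (star (W.hbar k l)) + W.estCov k l

lemma estimator_mul_Psi_mul_conjTranspose (k : Fin K) (l : Fin L) :
    W.estimator k l * W.Psi k l * (W.estimator k l)ᴴ = W.estCov k l := by
  have scale : ((1 - W.ρad) * Real.sqrt (W.pdd k * τ)) * ((1 - W.ρad) * Real.sqrt (W.pdd k * τ)) =
      (1 - W.ρad) ^ 2 * τ * W.pdd k := by
    rw [mul_mul_mul_comm, Real.mul_self_sqrt (mul_nonneg (W.pdd_nonneg k) (Nat.cast_nonneg _))]
    ring
  rw [conjTranspose_estimator, estimator, Matrix.smul_mul, Matrix.smul_mul, Matrix.mul_smul,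
    smul_smul, ← Complex.ofReal_mul, scale, estCov,
    nonsing_inv_mul_cancel_right _ _ (W.isUnit_det_Psi k l), Matrix.mul_assoc (W.R k l)]

lemma trace_mul_conjTranspose_estimator (k i : Fin K) (l : Fin L) :
    trace ((((1 - W.ρad) * Real.sqrt (W.pdd i * τ) : ℝ) : ℂ) • W.R i l * (W.estimator k l)ᴴ) =
      W.b k i l := by
  have scale : ((1 - W.ρad) * Real.sqrt (W.pdd i * τ)) * ((1 - W.ρad) * Real.sqrt (W.pdd k * τ)) =
      (1 - W.ρad) ^ 2 * τ * Real.sqrt (W.pdd k * W.pdd i) := by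
    rw [Real.sqrt_mul (W.pdd_nonneg i), Real.sqrt_mul (W.pdd_nonneg k),
      Real.sqrt_mul (W.pdd_nonneg k)]
    nth_rewrite 3 [← Real.mul_self_sqrt (Nat.cast_nonneg τ)]
    ring
  rw [conjTranspose_estimator, Matrix.smul_mul, Matrix.mul_smul, smul_smul, trace_smul,
    ← Complex.ofReal_mul, scale, b, smul_eq_mul, Matrix.mul_assoc (W.R i l)]

lemma estCov_posSemidef (k : Fin K) (l : Fin L) : (W.estCov k l).PosSemidef := by
  have hpsd := (W.Psi_posDef k l).inv.posSemidef.conjTranspose_mul_mul_same (W.R k l)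
  rw [(W.R_psd k l).isHermitian.eq] at hpsd
  exact hpsd.smul (Complex.zero_le_real.2 (mul_nonneg (by positivity) (W.pdd_nonneg k)))

lemma estMoment_posSemidef (k : Fin K) (l : Fin L) : (W.estMoment k l).PosSemidef :=
  (posSemidef_vecMulVec_self_star _).add (W.estCov_posSemidef k l)

lemma trace_estMoment (k : Fin K) (l : Fin L) :
    trace (W.estMoment k l) = star (W.hbar k l) ⬝ᵥ W.hbar k l + trace (W.estCov k l) := by
  rw [estMoment, trace_add, trace_vecMulVec, dotProduct_comm]

lemma lam_add_b (k : Fin K) (l : Fin L) : W.lam k k l + W.b k k l = trace (W.estMoment k l) := by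
  rw [trace_estMoment, lam, b, estCov, trace_smul, Real.sqrt_mul_self (W.pdd_nonneg k), smul_eq_mul]

lemma c_eq (k i : Fin K) (l : Fin L) :
    W.c k i l = trace (W.R i l * W.estCov k l) +
      star (W.hbar k l) ⬝ᵥ (W.R i l *ᵥ W.hbar k l) +
      star (W.hbar i l) ⬝ᵥ (W.estCov k l *ᵥ W.hbar i l) := by
  simp only [c, estCov, mul_smul_comm, trace_smul, smul_mulVec, dotProduct_smul, smul_eq_mul,
    mul_assoc]

lemma βLOS_nonneg (i : Fin K) (l : Fin L) : 0 ≤ W.βLOS i l :=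
  div_nonneg (mul_nonneg (W.κ_nonneg i l) (W.β_nonneg i l))
    (add_nonneg (W.κ_nonneg i l) zero_le_one)

lemma hbar_mul_conj (i : Fin K) (l : Fin L) (a : Fin N) :
    W.hbar i l a * conj (W.hbar i l a) = (W.βLOS i l : ℂ) := by
  have phase : -Complex.I * ((a : ℕ) : ℂ) * (Real.pi : ℂ) * (Real.sin (W.θ i l) : ℂ) =
      ((-(a : ℕ) * Real.pi * Real.sin (W.θ i l) : ℝ) : ℂ) * Complex.I := by
    push_cast
    ring
  rw [Complex.mul_conj', hbar, phase, norm_mul, Complex.norm_exp_ofReal_mul_I, mul_one,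
    Complex.norm_real, Real.norm_of_nonneg (Real.sqrt_nonneg _), ← Complex.ofReal_pow,
    Real.sq_sqrt (W.βLOS_nonneg i l)]

lemma diagonal_diag_S (l : Fin L) :
    diagonal (diag (W.S l)) =
      ((∑ i, W.pdd i * W.βLOS i l : ℝ) : ℂ) • (1 : Matrix (Fin N) (Fin N) ℂ) +
        diagonal (diag (∑ i, (W.pdd i : ℂ) • W.R i l)) := by
  have diag_S (a : Fin N) : W.S l a a =
      ((∑ i, W.pdd i * W.βLOS i l : ℝ) : ℂ) + (∑ i, (W.pdd i : ℂ) • W.R i l) a a := by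
    simp [S, Matrix.sum_apply, vecMulVec_apply, W.hbar_mul_conj, Finset.sum_add_distrib]
  rw [smul_one_eq_diagonal, diagonal_add]
  exact congrArg diagonal (funext diag_S)

lemma d_eq_trace (k : Fin K) (l : Fin L) : W.d k l = trace (W.rxCov l * W.estMoment k l) := by
  have sum_pdd_βLOS : ∑ i, W.pdd i * W.β i l * W.κ i l / (W.κ i l + 1) =
      ∑ i, W.pdd i * W.βLOS i l :=
    Finset.sum_congr rfl fun i _ => by rw [βLOS]; ring
  rw [d, rxCov, diagonal_diag_S, sum_pdd_βLOS]
  simp only [estMoment, estCov, add_mul, mul_add, smul_add, Matrix.smul_mul, Matrix.mul_smul,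
    Matrix.one_mul, trace_add, trace_smul, smul_eq_mul, mul_vecMulVec, trace_vecMulVec,
    smul_mulVec, one_mulVec, dotProduct_comm _ (star (W.hbar k l)), dotProduct_smul,
    ← Matrix.mul_assoc]
  push_cast
  ring

lemma trace_estMoment_pos {k : Fin K} {l : Fin L} (hp : 0 < W.p k)
    (h : W.hbar k l ≠ 0 ∨ W.R k l ≠ 0) : 0 < trace (W.estMoment k l) := by
  refine (W.estMoment_posSemidef k l).trace_nonneg.lt_of_ne' fun htrace => ?_
  rw [trace_estMoment] at htrace
  obtain ⟨hbar_sq, trace_estCov⟩ := (add_eq_zero_iff_of_nonneg (dotProduct_star_self_nonneg _)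
    (W.estCov_posSemidef k l).trace_nonneg).1 htrace
  have hscale : (((1 - W.ρad) ^ 2 * τ * W.pdd k : ℝ) : ℂ) ≠ 0 := by
    have hτ : (0 : ℝ) < τ := Nat.cast_pos.2 (Fin.pos (W.pilot k))
    have hda := W.one_sub_ρda_pos
    have had := W.one_sub_ρad_pos
    exact Complex.ofReal_ne_zero.2 (by rw [pdd]; positivity)
  have conj_eq_zero : (W.R k l)ᴴ * (W.Psi k l)⁻¹ * W.R k l = 0 := by
    rw [(W.R_psd k l).isHermitian.eq]
    exact (smul_eq_zero.1 ((W.estCov_posSemidef k l).trace_eq_zero_iff.1 trace_estCov)).resolve_left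
      hscale
  exact h.elim (· (dotProduct_star_self_eq_zero.1 hbar_sq))
    (· (eq_zero_of_conjTranspose_mul_mul_eq_zero (W.Psi_posDef k l).inv conj_eq_zero))

lemma d_pos {k : Fin K} {l : Fin L} (hp : 0 < W.p k)
    (h : W.hbar k l ≠ 0 ∨ W.R k l ≠ 0) : 0 < W.d k l := by
  have hda := W.one_sub_ρda_pos
  have had := W.one_sub_ρad_pos
  have hρ := W.ρad_nonneg
  have hσ := W.σsq_pos
  have diag_nonneg : 0 ≤ trace (diagonal (diag (W.S l)) * W.estMoment k l) :=
    trace_mul_nonneg (posSemidef_diagonal_iff.2 fun _ => (W.S_posSemidef l).diag_nonneg)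
      (W.estMoment_posSemidef k l)
  rw [d_eq_trace, rxCov, add_mul, trace_add, Matrix.smul_mul, Matrix.smul_mul, Matrix.one_mul,
    trace_smul, trace_smul]
  refine add_pos_of_nonneg_of_pos (mul_nonneg ?_ diag_nonneg)
    (mul_pos ?_ (W.trace_estMoment_pos hp h))
  · exact Complex.zero_le_real.2 (by positivity)
  · exact Complex.zero_lt_real.2 (by positivity)

lemma c_nonneg (k i : Fin K) (l : Fin L) : 0 ≤ W.c k i l := by
  rw [c_eq]
  exact add_nonneg (add_nonneg (trace_mul_nonneg (W.R_psd i l) (W.estCov_posSemidef k l))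
    ((W.R_psd i l).dotProduct_mulVec_nonneg _))
    ((W.estCov_posSemidef k l).dotProduct_mulVec_nonneg _)

/-- Closed form of the mean `E[g_{ki}]` of the effective channel. -/
def gMean (k i : Fin K) : W.M k → ℂ := W.lamV k i + if i ∈ W.PSet k then W.bV k i else 0

/-- Closed form of the second moment `E[g_{ki} g_{ki}ᴴ]` of the effective channel. -/
def gMoment (k i : Fin K) : Matrix (W.M k) (W.M k) ℂ :=
  vecMulVec (W.gMean k i) (star (W.gMean k i)) + diagonal fun l : W.M k => W.c k i l

lemma gMean_self (k : Fin K) : W.gMean k k = W.lamV k k + W.bV k k := by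
  simp [gMean, PSet]

lemma gMoment_posSemidef (k i : Fin K) : (W.gMoment k i).PosSemidef :=
  (posSemidef_vecMulVec_self_star _).add (posSemidef_diagonal_iff.2 fun _ => W.c_nonneg k i _)

lemma CMat_eq (k : Fin K) (Q : Finset (Fin K)) :
    W.CMat k Q = (((1 - W.ρad) ^ 2 / (1 - W.ρda) : ℝ) : ℂ) •
        ∑ i ∈ Q, (W.pdd i : ℂ) • W.gMoment k i
      - (((1 - W.ρad) ^ 2 * W.pdd k : ℝ) : ℂ) • vecMulVec (W.gMean k k) (star (W.gMean k k))
      + diagonal fun l : W.M k => W.d k l := by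
  rw [CMat, gMean_self, Finset.inter_comm, ← Finset.filter_mem_eq_inter, Finset.sum_filter,
    ← Finset.sum_add_distrib]
  congr 3
  refine Finset.sum_congr rfl fun i _ => ?_
  rw [gMoment, gMean]
  split_ifs
  · rw [← smul_add, star_add, add_vecMulVec, vecMulVec_add, vecMulVec_add]
    congr 1
    abel
  · simp only [add_zero]

/-- The self-interference term of `C_k` outweighs the subtracted signal term: what remains of it is
the power of the DAC distortion. -/
lemma CMat_eq_add {k : Fin K} {Q : Finset (Fin K)} (hk : k ∈ Q) :
    W.CMat k Q = (((1 - W.ρad) ^ 2 / (1 - W.ρda) : ℝ) : ℂ) •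
        (∑ i ∈ Q.erase k, (W.pdd i : ℂ) • W.gMoment k i +
          (W.pdd k : ℂ) • diagonal fun l : W.M k => W.c k k l)
      + (((1 - W.ρad) ^ 2 * W.pdd k * (W.ρda / (1 - W.ρda)) : ℝ) : ℂ) •
        vecMulVec (W.gMean k k) (star (W.gMean k k))
      + diagonal fun l : W.M k => W.d k l := by
  have hda := W.one_sub_ρda_pos.ne'
  have coefficient : (1 - W.ρad) ^ 2 * W.pdd k * (W.ρda / (1 - W.ρda)) =
      (1 - W.ρad) ^ 2 / (1 - W.ρda) * W.pdd k - (1 - W.ρad) ^ 2 * W.pdd k := by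
    field_simp
    ring
  rw [CMat_eq, ← Finset.sum_erase_add _ _ hk, coefficient, Complex.ofReal_sub, Complex.ofReal_mul,
    gMoment]
  module

lemma CMat_posDef {k : Fin K} (hp : 0 < W.p k)
    (h : ∀ l ∈ W.M k, W.hbar k l ≠ 0 ∨ W.R k l ≠ 0) {Q : Finset (Fin K)} (hk : k ∈ Q) :
    (W.CMat k Q).PosDef := by
  have hda := W.one_sub_ρda_pos
  have hρ := W.ρda_nonneg
  have hpdd (i : Fin K) : 0 ≤ (W.pdd i : ℂ) := Complex.zero_le_real.2 (W.pdd_nonneg i)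
  have others_psd : (∑ i ∈ Q.erase k, (W.pdd i : ℂ) • W.gMoment k i).PosSemidef :=
    posSemidef_sum _ fun i _ => (W.gMoment_posSemidef k i).smul (hpdd i)
  have c_psd : (diagonal fun l : W.M k => W.c k k l).PosSemidef :=
    posSemidef_diagonal_iff.2 fun _ => W.c_nonneg k k _
  have d_posDef : (diagonal fun l : W.M k => W.d k l).PosDef :=
    posDef_diagonal_iff.2 fun l => W.d_pos hp (h l l.2)
  rw [W.CMat_eq_add hk]
  refine PosDef.posSemidef_add (((others_psd.add (c_psd.smul (hpdd k))).smul ?_).add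
    ((posSemidef_vecMulVec_self_star _).smul ?_)) d_posDef
  · exact Complex.zero_le_real.2 (by positivity)
  · exact Complex.zero_le_real.2
      (mul_nonneg (mul_nonneg (sq_nonneg _) (W.pdd_nonneg k)) (by positivity))

lemma mem_QSet_self {k : Fin K} (hM : (W.M k).Nonempty) (hN : 0 < N) : k ∈ W.QSet k := by
  obtain ⟨l, hl⟩ := hM
  simp only [QSet, Finset.mem_filter, Finset.mem_univ, true_and]
  intro hD
  have entry := congrFun (congrFun hD (⟨0, hN⟩, l)) (⟨0, hN⟩, l)
  rw [D, ← blockDiagonal_mul, blockDiagonal_apply_eq] at entry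
  simp [hl] at entry

lemma antennas_pos {k : Fin K} {l : Fin L} (h : W.hbar k l ≠ 0 ∨ W.R k l ≠ 0) : 0 < N := by
  by_contra! hN
  obtain rfl : N = 0 := by omega
  exact h.elim (· (Subsingleton.elim _ _)) (· (Subsingleton.elim _ _))

lemma gMean_self_ne_zero {k : Fin K} (hp : 0 < W.p k) (hM : (W.M k).Nonempty)
    (h : ∀ l ∈ W.M k, W.hbar k l ≠ 0 ∨ W.R k l ≠ 0) : W.gMean k k ≠ 0 := by
  obtain ⟨l, hl⟩ := hM
  intro hzero
  have hpos := W.trace_estMoment_pos hp (h l hl)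
  rw [← lam_add_b] at hpos
  exact hpos.ne' (congrFun ((W.gMean_self k).symm.trans hzero) ⟨l, hl⟩)

end ClosedForms

end Network

section Sources

variable {K L τ : ℕ}

namespace Source

instance : Finite (Source K L τ) :=
  Finite.of_injective (β := (Fin K × Fin L) ⊕ (Fin L × Fin τ) ⊕ Fin K ⊕ Fin K ⊕ Fin L ⊕ Fin L)
    (fun
      | .chan i l => .inl (i, l)
      | .pilotNoise l t => .inr (.inl (l, t))
      | .sig i => .inr (.inr (.inl i))
      | .dac i => .inr (.inr (.inr (.inl i)))
      | .recv l => .inr (.inr (.inr (.inr (.inl l))))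
      | .adc l => .inr (.inr (.inr (.inr (.inr l)))))
    (by rintro ⟨⟩ ⟨⟩ h <;> simp_all)

instance : Fintype (Source K L τ) := Fintype.ofFinite _

/-- Distinguishes the symbols and noises of the data phase from the channels and the pilot noise,
which determine the channel estimates. -/
def isData : Source K L τ → Bool
  | .chan _ _ | .pilotNoise _ _ => false
  | .sig _ | .dac _ | .recv _ | .adc _ => true

end Source

/-- The sources that determine the channels and their estimates. -/
def pilotSources (K L τ : ℕ) : Finset (Source K L τ) := Finset.univ.filter fun s => s.isData = false

/-- The sources that enter only in the data phase. -/
def dataSources (K L τ : ℕ) : Finset (Source K L τ) := Finset.univ.filter fun s => s.isData = true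

lemma mem_pilotSources {s : Source K L τ} : s ∈ pilotSources K L τ ↔ s.isData = false := by
  simp [pilotSources]

lemma mem_dataSources {s : Source K L τ} : s ∈ dataSources K L τ ↔ s.isData = true := by
  simp [dataSources]

lemma disjoint_pilotSources_dataSources : Disjoint (pilotSources K L τ) (dataSources K L τ) :=
  Finset.disjoint_filter.2 fun _ _ hs => by simp [hs]

end Sources

namespace Network.IsModel

variable {K L N τ : ℕ} {W : Network K L N τ} {Ω : Type*} [MeasurableSpace Ω] {P : Measure Ω}
  {X : Sources K L N τ Ω}

lemma isCNFamily (hX : W.IsModel P X) : IsCNFamily P X where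
  indep := hX.indep
  exists_isCN
    | .chan i l => ⟨_, hX.chan i l⟩
    | .pilotNoise l t => ⟨_, hX.pilotNoise l t⟩
    | .sig i => ⟨_, hX.sig i⟩
    | .dac i => ⟨_, hX.dac i⟩
    | .recv l => ⟨_, hX.recv l⟩
    | .adc l => ⟨_, hX.adc l⟩

variable [IsProbabilityMeasure P] (hX : W.IsModel P X)

/-- The random vector `h_{w,il}`. -/
def scatter (i : Fin K) (l : Fin L) : Fin N → momentAlgebra P := hX.isCNFamily.vec (.chan i l)

/-- The column `t` of the pilot noise `N_l`. -/
def pilotNoiseVec (l : Fin L) (t : Fin τ) : Fin N → momentAlgebra P :=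
  hX.isCNFamily.vec (.pilotNoise l t)

lemma scatter_mem_coordSpan (i : Fin K) (l : Fin L) (a : Fin N) :
    hX.scatter i l a ∈ coordSpan P X (pilotSources K L τ) :=
  hX.isCNFamily.vec_mem_coordSpan (i := .chan i l) (mem_pilotSources.2 rfl) a

lemma pilotNoiseVec_mem_coordSpan (l : Fin L) (t : Fin τ) (a : Fin N) :
    hX.pilotNoiseVec l t a ∈ coordSpan P X (pilotSources K L τ) :=
  hX.isCNFamily.vec_mem_coordSpan (i := .pilotNoise l t) (mem_pilotSources.2 rfl) a

lemma crossMoment_scatter_scatter (i j : Fin K) (l l' : Fin L) :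
    crossMoment P (hX.scatter i l) (hX.scatter j l') = if l = l' ∧ i = j then W.R i l else 0 := by
  split_ifs with h
  · obtain ⟨rfl, rfl⟩ := h
    exact hX.isCNFamily.crossMoment_vec_self (hX.chan i l)
  · exact hX.isCNFamily.crossMoment_vec_of_ne (i := .chan i l) (j := .chan j l')
      (by simpa [and_comm] using h)

lemma crossMoment_pilotNoiseVec_pilotNoiseVec (l l' : Fin L) (t t' : Fin τ) :
    crossMoment P (hX.pilotNoiseVec l t) (hX.pilotNoiseVec l' t') =
      if l = l' ∧ t = t' then W.Cn l else 0 := by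
  split_ifs with h
  · obtain ⟨rfl, rfl⟩ := h
    exact hX.isCNFamily.crossMoment_vec_self (hX.pilotNoise l t)
  · exact hX.isCNFamily.crossMoment_vec_of_ne (i := .pilotNoise l t) (j := .pilotNoise l' t')
      (by simpa using h)

lemma crossMoment_scatter_pilotNoiseVec (i : Fin K) (l l' : Fin L) (t : Fin τ) :
    crossMoment P (hX.scatter i l) (hX.pilotNoiseVec l' t) = 0 :=
  hX.isCNFamily.crossMoment_vec_of_ne (i := .chan i l) (j := .pilotNoise l' t) nofun

lemma crossMoment_pilotNoiseVec_scatter (i : Fin K) (l l' : Fin L) (t : Fin τ) :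
    crossMoment P (hX.pilotNoiseVec l' t) (hX.scatter i l) = 0 :=
  hX.isCNFamily.crossMoment_vec_of_ne (i := .pilotNoise l' t) (j := .chan i l) nofun

/-- The centred correlated pilot signal `z^w_{kl}`. -/
def correlatedPilot (k : Fin K) (l : Fin L) : Fin N → momentAlgebra P :=
  ((1 - W.ρad : ℝ) : ℂ) • ∑ i ∈ W.PSet k, (Real.sqrt (W.pdd i * τ) : ℂ) • hX.scatter i l +
    ∑ t, W.correlator k t • hX.pilotNoiseVec l t

lemma realization_correlatedPilot (k : Fin K) (l : Fin L) (ω : Ω) :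
    realization (hX.correlatedPilot k l) ω = W.zw X k l ω := by
  simp only [correlatedPilot, realization_add, realization_smul, realization_sum, zw_eq]
  rfl

lemma correlatedPilot_mem_coordSpan (k : Fin K) (l : Fin L) (a : Fin N) :
    hX.correlatedPilot k l a ∈ coordSpan P X (pilotSources K L τ) := by
  simp only [correlatedPilot, Pi.add_apply, Pi.smul_apply, Finset.sum_apply]
  exact add_mem
    (Submodule.smul_mem _ _ (sum_mem fun i _ =>
      Submodule.smul_mem _ _ (hX.scatter_mem_coordSpan i l a)))
    (sum_mem fun t _ => Submodule.smul_mem _ _ (hX.pilotNoiseVec_mem_coordSpan l t a))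

lemma crossMoment_scatter_correlatedPilot (i k : Fin K) (l l' : Fin L) :
    crossMoment P (hX.scatter i l) (hX.correlatedPilot k l') =
      if l = l' ∧ i ∈ W.PSet k then
        (((1 - W.ρad) * Real.sqrt (W.pdd i * τ) : ℝ) : ℂ) • W.R i l else 0 := by
  simp only [correlatedPilot, map_add, map_smulₛₗ, map_sum, crossMoment_scatter_scatter,
    crossMoment_scatter_pilotNoiseVec, Complex.conj_ofReal, smul_zero, Finset.sum_const_zero,
    add_zero, ite_and, smul_ite]
  split_ifs <;> simp [*, smul_smul]

lemma crossMoment_pilotNoiseVec_correlatedPilot (k : Fin K) (l l' : Fin L) (t : Fin τ) :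
    crossMoment P (hX.pilotNoiseVec l t) (hX.correlatedPilot k l') =
      if l = l' then conj (W.correlator k t) • W.Cn l else 0 := by
  simp only [correlatedPilot, map_add, map_smulₛₗ, map_sum, crossMoment_pilotNoiseVec_scatter,
    crossMoment_pilotNoiseVec_pilotNoiseVec, smul_zero, Finset.sum_const_zero, zero_add, ite_and,
    smul_ite]
  split_ifs <;> simp [*]

lemma crossMoment_correlatedPilot_correlatedPilot (k : Fin K) (l l' : Fin L) :
    crossMoment P (hX.correlatedPilot k l) (hX.correlatedPilot k l') =
      if l = l' then W.Psi k l else 0 := by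
  have scatter_part (i : Fin K) :
      (Real.sqrt (W.pdd i * τ) : ℂ) • (((1 - W.ρad) * Real.sqrt (W.pdd i * τ) : ℝ) : ℂ) • W.R i l =
        ((1 - W.ρad : ℝ) : ℂ) • ((W.pdd i * τ : ℝ) : ℂ) • W.R i l := by
    have hnonneg : 0 ≤ W.pdd i * τ := mul_nonneg (W.pdd_nonneg i) (Nat.cast_nonneg _)
    rw [smul_smul, smul_smul, ← Complex.ofReal_mul, ← Complex.ofReal_mul, mul_left_comm,
      Real.mul_self_sqrt hnonneg]
  have noise_part : ∑ t, (W.correlator k t * conj (W.correlator k t)) • W.Cn l = W.Cn l := by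
    rw [← Finset.sum_smul]
    exact (congrArg (· • W.Cn l) (W.correlator_dotProduct_star_correlator k)).trans (one_smul _ _)
  nth_rewrite 1 [correlatedPilot]
  simp only [map_add, map_smul, map_sum, LinearMap.add_apply, LinearMap.smul_apply,
    LinearMap.sum_apply, crossMoment_scatter_correlatedPilot,
    crossMoment_pilotNoiseVec_correlatedPilot]
  split_ifs with h
  · simp only [h, true_and, smul_ite, smul_zero, Finset.sum_ite_mem, Finset.inter_self]
    subst h
    rw [Finset.sum_congr rfl fun i _ => scatter_part i, ← Finset.smul_sum, smul_smul,
      ← Complex.ofReal_mul, ← sq, Psi, Finset.sum_congr rfl fun t _ => smul_smul _ _ _, noise_part]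
  · simp [h]

/-- The random part `(1 - ρ_ad) √(p̈_k τ) R_{kl} Ψ⁻¹ z^w_{kl}` of the MMSE estimate. -/
def estScatter (k : Fin K) (l : Fin L) : Fin N → momentAlgebra P :=
  linearImage (W.estimator k l) (hX.correlatedPilot k l)

lemma estScatter_mem_coordSpan (k : Fin K) (l : Fin L) (a : Fin N) :
    hX.estScatter k l a ∈ coordSpan P X (pilotSources K L τ) :=
  linearImage_mem _ (hX.correlatedPilot_mem_coordSpan k l) a

lemma trace_crossMoment_scatter_estScatter (k i : Fin K) (l : Fin L) :
    trace (crossMoment P (hX.scatter i l) (hX.estScatter k l)) =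
      if i ∈ W.PSet k then W.b k i l else 0 := by
  rw [estScatter, crossMoment_linearImage_right, crossMoment_scatter_correlatedPilot]
  simp only [true_and]
  split_ifs
  · exact W.trace_mul_conjTranspose_estimator k i l
  · rw [Matrix.zero_mul, trace_zero]

lemma crossMoment_estScatter_estScatter (k : Fin K) (l l' : Fin L) :
    crossMoment P (hX.estScatter k l) (hX.estScatter k l') =
      if l = l' then W.estCov k l else 0 := by
  rw [estScatter, estScatter, crossMoment_linearImage_left, crossMoment_linearImage_right,
    crossMoment_correlatedPilot_correlatedPilot]
  split_ifs with h
  · subst h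
    rw [← mul_assoc, W.estimator_mul_Psi_mul_conjTranspose]
  · rw [Matrix.zero_mul, Matrix.mul_zero]

/-- The channel `h_{il}` as a vector of random variables. -/
def channel (i : Fin K) (l : Fin L) : Fin N → momentAlgebra P :=
  constVec P (W.hbar i l) + hX.scatter i l

/-- The MMSE estimate `ĥ_{kl}` as a vector of random variables. -/
def estimate (k : Fin K) (l : Fin L) : Fin N → momentAlgebra P :=
  constVec P (W.hbar k l) + hX.estScatter k l

/-- The entries `ĥ_{kl}ᴴ h_{il}` of the effective channel `g_{ki}`. -/
def gain (k i : Fin K) (l : W.M k) : momentAlgebra P :=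
  star (hX.estimate k l) ⬝ᵥ hX.channel i l

lemma realization_estimate (k : Fin K) (l : Fin L) (ω : Ω) :
    realization (hX.estimate k l) ω = W.hhat X k l ω := by
  rw [estimate, realization_constVec_add, estScatter, realization_linearImage,
    realization_correlatedPilot, hhat, estimator, smul_mulVec]

lemma realization_gain (k i : Fin K) : realization (hX.gain k i) = W.g X (W.hhat X) k i := by
  ext ω l
  rw [g, ← hX.realization_estimate]
  exact coe_dotProduct _ _ ω

lemma expect_scatter (i : Fin K) (l : Fin L) (a : Fin N) : expect P (hX.scatter i l a) = 0 :=
  hX.isCNFamily.expect_eq_zero (hX.scatter_mem_coordSpan i l a)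

lemma expect_estScatter (k : Fin K) (l : Fin L) (a : Fin N) :
    expect P (hX.estScatter k l a) = 0 :=
  hX.isCNFamily.expect_eq_zero (hX.estScatter_mem_coordSpan k l a)

lemma expect_gain (k i : Fin K) (l : W.M k) : expect P (hX.gain k i l) = W.gMean k i l := by
  rw [gain, estimate, channel, expect_star_dotProduct_constVec_add (hX.expect_estScatter k l)
    (hX.expect_scatter i l), trace_crossMoment_scatter_estScatter, gMean, Pi.add_apply]
  split_ifs <;> rfl

lemma crossMoment_gain_gain (k i : Fin K) :
    crossMoment P (hX.gain k i) (hX.gain k i) = W.gMoment k i := by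
  have mem_linearForms {y : momentAlgebra P} (hy : y ∈ coordSpan P X (pilotSources K L τ)) :
      y ∈ (linearForms P fun ω s => X s ω).toAddSubgroup := coordSpan_le_linearForms hy
  ext l l'
  have second_moment := expect_star_dotProduct_mul_star_star_dotProduct
    hX.isCNFamily.hasGaussianMoments (fun _ => star_mem_linearForms)
    (a := W.hbar k l) (b := W.hbar i l) (a' := W.hbar k l') (b' := W.hbar i l')
    (fun a => mem_linearForms (hX.estScatter_mem_coordSpan k l a))
    (fun a => mem_linearForms (hX.scatter_mem_coordSpan i l a))
    (fun a => mem_linearForms (hX.estScatter_mem_coordSpan k l' a))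
    (fun a => mem_linearForms (hX.scatter_mem_coordSpan i l' a))
    (hX.isCNFamily.crossMoment_star_eq_zero (hX.estScatter_mem_coordSpan k l)
      (hX.scatter_mem_coordSpan i l'))
    (hX.isCNFamily.crossMoment_star_eq_zero (hX.scatter_mem_coordSpan i l)
      (hX.estScatter_mem_coordSpan k l'))
  have mean (l : W.M k) : expect P (star (constVec P (W.hbar k l) + hX.estScatter k l) ⬝ᵥ
      (constVec P (W.hbar i l) + hX.scatter i l)) = W.gMean k i l := hX.expect_gain k i l
  rw [mean, mean] at second_moment
  rw [crossMoment_apply, gMoment, Matrix.add_apply, vecMulVec_apply, diagonal_apply]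
  refine second_moment.trans (congrArg (W.gMean k i l * conj (W.gMean k i l') + ·) ?_)
  rw [crossMoment_scatter_scatter, crossMoment_estScatter_estScatter]
  by_cases hl : l = l'
  · subst hl
    simp only [and_self, if_true]
    rw [c_eq]
    ring
  · have hl_coe : ¬(l : Fin L) = l' := fun h => hl (Subtype.ext h)
    simp only [hl, hl_coe, Ne.symm hl_coe, false_and, if_false, zero_mulVec, dotProduct_zero,
      Matrix.zero_mul, trace_zero, add_zero]

include hX in
lemma expVec_g (k i : Fin K) : expVec P (W.g X (W.hhat X) k i) = W.gMean k i := by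
  rw [← hX.realization_gain]
  exact funext (hX.expect_gain k i)

include hX in
lemma expOuter_g (k i : Fin K) : expOuter P (W.g X (W.hhat X) k i) = W.gMoment k i := by
  rw [← hX.realization_gain, expOuter_realization, crossMoment_gain_gain]

end Network.IsModel

namespace Network.IsModel

variable {K L N τ : ℕ} {W : Network K L N τ} {Ω : Type*} [MeasurableSpace Ω] {P : Measure Ω}
  {X : Sources K L N τ Ω} [IsProbabilityMeasure P] (hX : W.IsModel P X)

lemma channel_mem_dependsOn (i : Fin K) (l : Fin L) (a : Fin N) :
    hX.channel i l a ∈ dependsOn P X (pilotSources K L τ) :=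
  add_mem (algebraMap_mem _ _) (mem_dependsOn_of_mem_coordSpan (hX.scatter_mem_coordSpan i l a))

lemma estimate_mem_dependsOn (k : Fin K) (l : Fin L) (a : Fin N) :
    hX.estimate k l a ∈ dependsOn P X (pilotSources K L τ) :=
  add_mem (algebraMap_mem _ _)
    (mem_dependsOn_of_mem_coordSpan (hX.estScatter_mem_coordSpan k l a))

lemma gain_mem_dependsOn (k i : Fin K) (l : W.M k) :
    hX.gain k i l ∈ dependsOn P X (pilotSources K L τ) :=
  sum_mem fun a _ =>
    mul_mem (star_mem (hX.estimate_mem_dependsOn k l a)) (hX.channel_mem_dependsOn i l a)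

lemma crossMoment_channel_channel (i : Fin K) (l : Fin L) :
    crossMoment P (hX.channel i l) (hX.channel i l) =
      vecMulVec (W.hbar i l) (star (W.hbar i l)) + W.R i l := by
  rw [channel, crossMoment_constVec_add (hX.expect_scatter i l) (hX.expect_scatter i l),
    crossMoment_scatter_scatter, if_pos ⟨rfl, rfl⟩]

lemma crossMoment_estimate_estimate (k : Fin K) (l : Fin L) :
    crossMoment P (hX.estimate k l) (hX.estimate k l) = W.estMoment k l := by
  rw [estimate, crossMoment_constVec_add (hX.expect_estScatter k l) (hX.expect_estScatter k l),
    crossMoment_estScatter_estScatter, if_pos rfl, estMoment]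

/-- The data symbols `s_i`. -/
def symbol (i : Fin K) : momentAlgebra P := hX.isCNFamily.vec (.sig i) (0 : Fin 1)

/-- The DAC noises `n_{da,i}` of the data phase. -/
def dacNoise (i : Fin K) : momentAlgebra P := hX.isCNFamily.vec (.dac i) (0 : Fin 1)

/-- The receiver noise `n_{an,l}` of the data phase. -/
def recvNoise (l : Fin L) : Fin N → momentAlgebra P := hX.isCNFamily.vec (.recv l)

/-- The ADC noise `n_{ad,l}` of the data phase. -/
def adcNoise (l : Fin L) : Fin N → momentAlgebra P := hX.isCNFamily.vec (.adc l)

lemma symbol_mem_coordSpan (i : Fin K) :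
    hX.symbol i ∈ coordSpan P X (dataSources K L τ) :=
  hX.isCNFamily.vec_mem_coordSpan (i := .sig i) (mem_dataSources.2 rfl) _

lemma dacNoise_mem_coordSpan (i : Fin K) :
    hX.dacNoise i ∈ coordSpan P X (dataSources K L τ) :=
  hX.isCNFamily.vec_mem_coordSpan (i := .dac i) (mem_dataSources.2 rfl) _

lemma recvNoise_mem_coordSpan (l : Fin L) (a : Fin N) :
    hX.recvNoise l a ∈ coordSpan P X (dataSources K L τ) :=
  hX.isCNFamily.vec_mem_coordSpan (i := .recv l) (mem_dataSources.2 rfl) a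

lemma adcNoise_mem_coordSpan (l : Fin L) (a : Fin N) :
    hX.adcNoise l a ∈ coordSpan P X (dataSources K L τ) :=
  hX.isCNFamily.vec_mem_coordSpan (i := .adc l) (mem_dataSources.2 rfl) a

lemma crossMoment_symbol_symbol :
    crossMoment P hX.symbol hX.symbol = diagonal fun i => (W.p i : ℂ) := by
  ext i j
  rw [diagonal_apply]
  split_ifs with h
  · subst h
    have hcov := congrFun₂ (hX.isCNFamily.crossMoment_vec_self (hX.sig i)) (0 : Fin 1) (0 : Fin 1)
    exact hcov.trans (mul_one _)
  · exact hX.isCNFamily.expect_vec_mul_star_vec_of_ne (i := .sig i) (j := .sig j) (by simpa) _ _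

lemma crossMoment_dacNoise_dacNoise :
    crossMoment P hX.dacNoise hX.dacNoise = diagonal fun i => ((W.ρda * W.p i : ℝ) : ℂ) := by
  ext i j
  rw [diagonal_apply]
  split_ifs with h
  · subst h
    have hcov := congrFun₂ (hX.isCNFamily.crossMoment_vec_self (hX.dac i)) (0 : Fin 1) (0 : Fin 1)
    exact hcov.trans (mul_one _)
  · exact hX.isCNFamily.expect_vec_mul_star_vec_of_ne (i := .dac i) (j := .dac j) (by simpa) _ _

lemma crossMoment_symbol_dacNoise : crossMoment P hX.symbol hX.dacNoise = 0 := by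
  ext i j
  exact hX.isCNFamily.expect_vec_mul_star_vec_of_ne (i := .sig i) (j := .dac j) nofun _ _

/-- The signals `√(1 - ρ_da) s_i + n_{da,i}` sent by the UEs. -/
def transmitted : Fin K → momentAlgebra P :=
  (Real.sqrt (1 - W.ρda) : ℂ) • hX.symbol + hX.dacNoise

lemma transmitted_mem_coordSpan (i : Fin K) :
    hX.transmitted i ∈ coordSpan P X (dataSources K L τ) :=
  add_mem (Submodule.smul_mem _ _ (hX.symbol_mem_coordSpan i)) (hX.dacNoise_mem_coordSpan i)

lemma crossMoment_transmitted_transmitted :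
    crossMoment P hX.transmitted hX.transmitted = diagonal fun i => (W.p i : ℂ) := by
  have dac_symbol : crossMoment P hX.dacNoise hX.symbol = 0 := by
    rw [← crossMoment_conjTranspose, crossMoment_symbol_dacNoise, conjTranspose_zero]
  have sqrt_sq : (Real.sqrt (1 - W.ρda) : ℂ) * (Real.sqrt (1 - W.ρda) : ℂ) = 1 - W.ρda := by
    rw [← Complex.ofReal_mul, Real.mul_self_sqrt W.one_sub_ρda_pos.le, Complex.ofReal_sub,
      Complex.ofReal_one]
  simp only [transmitted, map_add, map_smul, map_smulₛₗ, LinearMap.add_apply, LinearMap.smul_apply,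
    crossMoment_symbol_symbol, crossMoment_dacNoise_dacNoise, crossMoment_symbol_dacNoise,
    dac_symbol, smul_zero, add_zero, zero_add, Complex.conj_ofReal, smul_smul, sqrt_sq]
  rw [← diagonal_smul, diagonal_add]
  congr 1
  ext i
  simp only [Pi.smul_apply, smul_eq_mul, Complex.ofReal_mul]
  ring

lemma crossMoment_recvNoise_recvNoise (l : Fin L) :
    crossMoment P (hX.recvNoise l) (hX.recvNoise l) = (W.σsq : ℂ) • 1 :=
  hX.isCNFamily.crossMoment_vec_self (hX.recv l)

lemma crossMoment_transmitted_recvNoise (l : Fin L) :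
    crossMoment P hX.transmitted (hX.recvNoise l) = 0 := by
  have symbol_recv : crossMoment P hX.symbol (hX.recvNoise l) = 0 := by
    ext i a
    exact hX.isCNFamily.expect_vec_mul_star_vec_of_ne (i := .sig i) (j := .recv l) nofun _ _
  have dac_recv : crossMoment P hX.dacNoise (hX.recvNoise l) = 0 := by
    ext i a
    exact hX.isCNFamily.expect_vec_mul_star_vec_of_ne (i := .dac i) (j := .recv l) nofun _ _
  rw [transmitted, map_add, map_smul, LinearMap.add_apply, LinearMap.smul_apply, symbol_recv,
    dac_recv, smul_zero, add_zero]

/-- The input of the ADCs at AP `l`. -/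
def adcInput (l : Fin L) (a : Fin N) : momentAlgebra P :=
  (fun i => hX.channel i l a) ⬝ᵥ hX.transmitted + (fun _ : Unit => 1) ⬝ᵥ fun _ => hX.recvNoise l a

lemma realization_adcInput (l : Fin L) (ω : Ω) :
    realization (hX.adcInput l) ω = W.adcIn X l ω := by
  ext a
  refine (congrArg₂ (· + ·) (coe_dotProduct (fun i => hX.channel i l a) hX.transmitted ω)
    (coe_dotProduct (fun _ : Unit => 1) (fun _ => hX.recvNoise l a) ω)).trans ?_
  simp only [adcIn, Pi.add_apply, Finset.sum_apply, Pi.smul_apply, smul_eq_mul]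
  exact congrArg₂ (· + ·) (Finset.sum_congr rfl fun i _ => mul_comm _ _)
    ((Fintype.sum_unique _).trans (one_mul _))

lemma expect_adcInput_mul_star (l : Fin L) (a : Fin N) :
    expect P (hX.adcInput l a * star (hX.adcInput l a)) =
      ((1 - W.ρda : ℝ) : ℂ)⁻¹ * W.S l a a + W.σsq := by
  have recv_transmitted : crossMoment P (fun _ : Unit => hX.recvNoise l a) hX.transmitted = 0 := by
    rw [← crossMoment_conjTranspose]
    ext _ i
    exact (congrArg conj (congrFun₂ (hX.crossMoment_transmitted_recvNoise l) i a)).trans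
      (map_zero _)
  rw [adcInput, expect_add_dotProduct_mul_star_add_dotProduct hX.indep
    (fun s => (hX.isCNFamily.hasGaussianLaw s).aemeasurable) disjoint_pilotSources_dataSources
    (fun i => hX.channel_mem_dependsOn i l a) (fun i => hX.channel_mem_dependsOn i l a)
    (fun _ => one_mem _) (fun _ => one_mem _)
    (fun i => mem_dependsOn_of_mem_coordSpan (hX.transmitted_mem_coordSpan i))
    (fun _ => mem_dependsOn_of_mem_coordSpan (hX.recvNoise_mem_coordSpan l a))
    (fun _ => mem_dependsOn_of_mem_coordSpan (hX.recvNoise_mem_coordSpan l a))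
    (by ext i _; exact congrFun₂ (hX.crossMoment_transmitted_recvNoise l) i a) recv_transmitted,
    crossMoment_transmitted_transmitted]
  have hda : ((1 - W.ρda : ℝ) : ℂ) ≠ 0 := Complex.ofReal_ne_zero.2 W.one_sub_ρda_pos.ne'
  have signal_power : trace (diagonal (fun i => (W.p i : ℂ)) *
      (crossMoment P (fun i => hX.channel i l a) fun i => hX.channel i l a)ᵀ) =
        ((1 - W.ρda : ℝ) : ℂ)⁻¹ * W.S l a a := by
    rw [S, Matrix.sum_apply, Finset.mul_sum, trace]
    refine Finset.sum_congr rfl fun i _ => ?_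
    rw [diag_apply, diagonal_mul, transpose_apply]
    refine (congrArg _ (congrFun₂ (hX.crossMoment_channel_channel i l) a a)).trans ?_
    rw [Matrix.smul_apply, smul_eq_mul, pdd, Complex.ofReal_mul, mul_assoc,
      inv_mul_cancel_left₀ hda]
  have noise_power : trace (crossMoment P (fun _ : Unit => hX.recvNoise l a)
      (fun _ : Unit => hX.recvNoise l a) *
        (crossMoment P (fun _ : Unit => (1 : momentAlgebra P)) fun _ : Unit => 1)ᵀ) = W.σsq := by
    have hrecv := congrFun₂ (hX.crossMoment_recvNoise_recvNoise l) a a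
    rw [crossMoment_apply] at hrecv
    simp [trace, mul_apply, crossMoment_apply, hrecv, expect_one, -star_mul]
  rw [signal_power, noise_power]

include hX in
lemma Cad_eq (l : Fin L) :
    W.Cad P X l = ((W.ρad * (1 - W.ρad) / (1 - W.ρda) : ℝ) : ℂ) • diagonal (diag (W.S l)) +
      ((W.ρad * (1 - W.ρad) * W.σsq : ℝ) : ℂ) • 1 := by
  have power (a : Fin N) : ∫ ω, W.adcIn X l ω a * conj (W.adcIn X l ω a) ∂P =
      ((1 - W.ρda : ℝ) : ℂ)⁻¹ * W.S l a a + W.σsq := by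
    simp only [← hX.realization_adcInput]
    exact hX.expect_adcInput_mul_star l a
  rw [Cad, funext power, smul_one_eq_diagonal, ← diagonal_smul, ← diagonal_smul, diagonal_add]
  congr 1
  ext a
  simp only [Pi.smul_apply, smul_eq_mul, diag_apply]
  push_cast
  ring

/-- The noise `(1 - ρ_ad) n_{an,l} + n_{ad,l}` added by the receiver of AP `l`. -/
def rxNoise (l : Fin L) : Fin N → momentAlgebra P :=
  ((1 - W.ρad : ℝ) : ℂ) • hX.recvNoise l + hX.adcNoise l

lemma rxNoise_mem_coordSpan (l : Fin L) (a : Fin N) :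
    hX.rxNoise l a ∈ coordSpan P X (dataSources K L τ) :=
  add_mem (Submodule.smul_mem _ _ (hX.recvNoise_mem_coordSpan l a)) (hX.adcNoise_mem_coordSpan l a)

lemma crossMoment_dacNoise_rxNoise (l : Fin L) :
    crossMoment P hX.dacNoise (hX.rxNoise l) = 0 := by
  have dac_recv : crossMoment P hX.dacNoise (hX.recvNoise l) = 0 := by
    ext i a
    exact hX.isCNFamily.expect_vec_mul_star_vec_of_ne (i := .dac i) (j := .recv l) nofun _ _
  have dac_adc : crossMoment P hX.dacNoise (hX.adcNoise l) = 0 := by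
    ext i a
    exact hX.isCNFamily.expect_vec_mul_star_vec_of_ne (i := .dac i) (j := .adc l) nofun _ _
  rw [rxNoise, map_add, map_smulₛₗ, dac_recv, dac_adc, smul_zero, add_zero]

lemma crossMoment_rxNoise_rxNoise (l l' : Fin L) :
    crossMoment P (hX.rxNoise l) (hX.rxNoise l') = if l = l' then W.rxCov l else 0 := by
  have recv_adc : crossMoment P (hX.recvNoise l) (hX.adcNoise l') = 0 :=
    hX.isCNFamily.crossMoment_vec_of_ne (i := .recv l) (j := .adc l') nofun
  have adc_recv : crossMoment P (hX.adcNoise l) (hX.recvNoise l') = 0 :=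
    hX.isCNFamily.crossMoment_vec_of_ne (i := .adc l) (j := .recv l') nofun
  simp only [rxNoise, map_add, map_smul, map_smulₛₗ, LinearMap.add_apply, LinearMap.smul_apply,
    recv_adc, adc_recv, smul_zero, add_zero, zero_add, Complex.conj_ofReal, smul_smul]
  split_ifs with h
  · subst h
    have adc_adc : crossMoment P (hX.adcNoise l) (hX.adcNoise l) = W.Cad P X l :=
      hX.isCNFamily.crossMoment_vec_self (hX.adc l)
    rw [crossMoment_recvNoise_recvNoise, adc_adc, hX.Cad_eq, rxCov]
    push_cast
    module
  · have recv_recv : crossMoment P (hX.recvNoise l) (hX.recvNoise l') = 0 :=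
      hX.isCNFamily.crossMoment_vec_of_ne (i := .recv l) (j := .recv l') (by simpa)
    have adc_adc : crossMoment P (hX.adcNoise l) (hX.adcNoise l') = 0 :=
      hX.isCNFamily.crossMoment_vec_of_ne (i := .adc l) (j := .adc l') (by simpa)
    rw [recv_recv, adc_adc, smul_zero, add_zero]

/-- The entries `ĥ_{kl}ᴴ n_l` of the combined noise `f_k`. -/
def combinedNoise (k : Fin K) (l : W.M k) : momentAlgebra P :=
  (((1 - W.ρad : ℝ) : ℂ) • fun i => hX.gain k i l) ⬝ᵥ hX.dacNoise +
    star (hX.estimate k l) ⬝ᵥ hX.rxNoise l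

lemma realization_combinedNoise (k : Fin K) :
    realization (hX.combinedNoise k) = W.f X (W.hhat X) k := by
  ext ω l
  refine (congrArg₂ (· + ·)
    (coe_dotProduct (((1 - W.ρad : ℝ) : ℂ) • fun i => hX.gain k i l) hX.dacNoise ω)
    (coe_dotProduct (star (hX.estimate k l)) (hX.rxNoise l) ω)).trans ?_
  rw [f, ← hX.realization_estimate, nEff, add_assoc, dotProduct_add]
  refine congrArg₂ (· + ·) ?_ rfl
  rw [realization_smul, smul_dotProduct, dotProduct_smul, dotProduct_sum]
  refine congrArg _ (Finset.sum_congr rfl fun i _ => ?_)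
  rw [dotProduct_smul, smul_eq_mul, mul_comm]
  exact congrArg _ (coe_dotProduct _ _ ω)

lemma trace_crossMoment_dacNoise_mul_crossMoment_gain (k : Fin K) (l l' : W.M k) :
    trace (crossMoment P hX.dacNoise hX.dacNoise *
        (crossMoment P (((1 - W.ρad : ℝ) : ℂ) • fun i => hX.gain k i l)
          (((1 - W.ρad : ℝ) : ℂ) • fun i => hX.gain k i l'))ᵀ) =
      (((1 - W.ρad) ^ 2 * W.ρda / (1 - W.ρda) : ℝ) : ℂ) *
        (∑ i, (W.pdd i : ℂ) • W.gMoment k i) l l' := by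
  have hda : (1 - W.ρda : ℂ) ≠ 0 := by exact_mod_cast W.one_sub_ρda_pos.ne'
  have gain_gain (i : Fin K) : crossMoment P (fun i => hX.gain k i l)
      (fun i => hX.gain k i l') i i = W.gMoment k i l l' :=
    congrFun₂ (hX.crossMoment_gain_gain k i) l l'
  simp only [map_smul, map_smulₛₗ, LinearMap.smul_apply, Complex.conj_ofReal, transpose_smul,
    Matrix.mul_smul, crossMoment_dacNoise_dacNoise, Matrix.smul_apply,
    Matrix.sum_apply, smul_eq_mul, trace, Finset.mul_sum, diag_apply, diagonal_mul,
    transpose_apply, gain_gain, pdd]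
  refine Finset.sum_congr rfl fun i _ => ?_
  push_cast
  field_simp

lemma trace_crossMoment_rxNoise_mul_crossMoment_estimate (k : Fin K) (l l' : W.M k) :
    trace (crossMoment P (hX.rxNoise l) (hX.rxNoise l') *
        (crossMoment P (star (hX.estimate k l)) (star (hX.estimate k l')))ᵀ) =
      diagonal (fun l : W.M k => W.d k l) l l' := by
  rw [crossMoment_rxNoise_rxNoise, crossMoment_star_star, transpose_transpose]
  by_cases h : l = l'
  · subst h
    rw [if_pos rfl, crossMoment_estimate_estimate, diagonal_apply_eq, d_eq_trace]
  · rw [if_neg (fun h' => h (Subtype.ext h')), Matrix.zero_mul, trace_zero, diagonal_apply_ne _ h]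

include hX in
lemma expOuter_f (k : Fin K) : expOuter P (W.f X (W.hhat X) k) =
    (((1 - W.ρad) ^ 2 * W.ρda / (1 - W.ρda) : ℝ) : ℂ) •
        ∑ i, (W.pdd i : ℂ) • W.gMoment k i + diagonal fun l : W.M k => W.d k l := by
  rw [← hX.realization_combinedNoise, expOuter_realization]
  ext l l'
  rw [crossMoment_apply, combinedNoise, combinedNoise,
    expect_add_dotProduct_mul_star_add_dotProduct
    (t := ((1 - W.ρad : ℝ) : ℂ) • fun i => hX.gain k i l)
    (t' := ((1 - W.ρad : ℝ) : ℂ) • fun i => hX.gain k i l')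
    (s := star (hX.estimate k l)) (s' := star (hX.estimate k l')) hX.indep
    (fun s => (hX.isCNFamily.hasGaussianLaw s).aemeasurable) disjoint_pilotSources_dataSources
    (fun i => Subalgebra.smul_mem _ (hX.gain_mem_dependsOn k i l) _)
    (fun i => Subalgebra.smul_mem _ (hX.gain_mem_dependsOn k i l') _)
    (fun a => star_mem (hX.estimate_mem_dependsOn k l a))
    (fun a => star_mem (hX.estimate_mem_dependsOn k l' a))
    (fun i => mem_dependsOn_of_mem_coordSpan (hX.dacNoise_mem_coordSpan i))
    (fun a => mem_dependsOn_of_mem_coordSpan (hX.rxNoise_mem_coordSpan l a))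
    (fun a => mem_dependsOn_of_mem_coordSpan (hX.rxNoise_mem_coordSpan l' a))
    (hX.crossMoment_dacNoise_rxNoise l')
    (by rw [← crossMoment_conjTranspose, crossMoment_dacNoise_rxNoise, conjTranspose_zero])]
  rw [trace_crossMoment_dacNoise_mul_crossMoment_gain,
    trace_crossMoment_rxNoise_mul_crossMoment_estimate]
  rfl

include hX in
lemma integral_norm_sq_g (k i : Fin K) (a : W.M k → ℂ) :
    ∫ ω, ‖star a ⬝ᵥ W.g X (W.hhat X) k i ω‖ ^ 2 ∂P = (star a ⬝ᵥ (W.gMoment k i *ᵥ a)).re := by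
  rw [← hX.realization_gain, integral_norm_sq_star_dotProduct, crossMoment_gain_gain]

include hX in
lemma aPMR_eq (k : Fin K) : W.aPMR P X k = (W.CP k)⁻¹ *ᵥ W.gMean k k := by
  rw [CP, CMat_eq, aPMR]
  simp only [hX.expVec_g, hX.expOuter_g]
  congr 2
  abel

include hX in
lemma ulSE_eq (τc : ℕ) (k : Fin K) (a : W.M k → ℂ) :
    W.ulSE P X τc (W.hhat X) k a =
      (1 - (τ : ℝ) / (τc : ℝ)) * Real.logb 2 (1 +
        (1 - W.ρad) ^ 2 * W.pdd k * ‖star a ⬝ᵥ W.gMean k k‖ ^ 2 /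
          (star a ⬝ᵥ (W.C k *ᵥ a)).re) := by
  have hda := W.one_sub_ρda_pos.ne'
  have signal : (star a ⬝ᵥ (vecMulVec (W.gMean k k) (star (W.gMean k k)) *ᵥ a)).re =
      ‖star a ⬝ᵥ W.gMean k k‖ ^ 2 := by
    have conj_inner : star (W.gMean k k) ⬝ᵥ a = conj (star a ⬝ᵥ W.gMean k k) := star_dotProduct _ _
    rw [vecMulVec_mulVec, dotProduct_smul, op_smul_eq_mul, conj_inner, Complex.mul_conj',
      ← Complex.ofReal_pow, Complex.ofReal_re]
  have denominator : (star a ⬝ᵥ (W.C k *ᵥ a)).re =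
      (1 - W.ρad) ^ 2 * ∑ i, W.pdd i * ∫ ω, ‖star a ⬝ᵥ W.g X (W.hhat X) k i ω‖ ^ 2 ∂P
        - (1 - W.ρad) ^ 2 * W.pdd k * ‖star a ⬝ᵥ W.gMean k k‖ ^ 2
        + (star a ⬝ᵥ (expOuter P (W.f X (W.hhat X) k) *ᵥ a)).re := by
    rw [C, CMat_eq, hX.expOuter_f]
    simp only [add_mulVec, sub_mulVec, smul_mulVec, dotProduct_add, dotProduct_sub,
      dotProduct_smul, smul_eq_mul, sum_mulVec, dotProduct_sum, hX.integral_norm_sq_g,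
      Complex.add_re, Complex.sub_re, Complex.re_ofReal_mul, Complex.re_sum, signal]
    field_simp
    ring
  rw [ulSE, hX.expVec_g, denominator]

end Network.IsModel

end SCF

end

theorem mainTheorem4 {K L N τ τc : ℕ} (hτ : τ ≤ τc) (W : SCF.Network K L N τ)
    {Ω : Type*} [MeasurableSpace Ω] (P : MeasureTheory.Measure Ω)
    [MeasureTheory.IsProbabilityMeasure P] (X : SCF.Sources K L N τ Ω)
    (hX : W.IsModel P X) (k : Fin K) :
    -- the P-LSFD vector in closed form
    W.aPMR P X k = (W.CP k)⁻¹ *ᵥ (W.lamV k k + W.bV k k) ∧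
    -- the spectral efficiency with MRC at the APs and the P-LSFD vector at the CPU
    W.ulSE P X τc (W.hhat X) k (W.aPMR P X k) =
      (1 - (τ : ℝ) / (τc : ℝ)) * Real.logb 2 (1 +
        (1 - W.ρad) ^ 2 * W.pdd k * ‖star (W.aPMR P X k) ⬝ᵥ (W.lamV k k + W.bV k k)‖ ^ 2 /
          (star (W.aPMR P X k) ⬝ᵥ (W.C k *ᵥ W.aPMR P X k)).re) ∧
    -- the inverse and the quotient are meaningful
    (0 < W.p k → (W.M k).Nonempty → (∀ l ∈ W.M k, W.hbar k l ≠ 0 ∨ W.R k l ≠ 0) →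
      IsUnit (W.CP k).det ∧
        0 < star (W.aPMR P X k) ⬝ᵥ (W.C k *ᵥ W.aPMR P X k)) := by
  rw [← W.gMean_self]
  refine ⟨hX.aPMR_eq k, hX.ulSE_eq τc k _, fun hp hM h => ?_⟩
  have ⟨l, hl⟩ := hM
  have hCP : (W.CP k).PosDef := W.CMat_posDef hp h (W.mem_QSet_self hM (W.antennas_pos (h l hl)))
  have hC : (W.C k).PosDef := W.CMat_posDef hp h (Finset.mem_univ k)
  have hunit : IsUnit (W.CP k).det := (isUnit_iff_isUnit_det _).1 hCP.isUnit
  have CP_mulVec_aPMR : W.CP k *ᵥ W.aPMR P X k = W.gMean k k := by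
    rw [hX.aPMR_eq, mulVec_mulVec, mul_nonsing_inv _ hunit, one_mulVec]
  refine ⟨hunit, hC.dotProduct_mulVec_pos fun h0 => W.gMean_self_ne_zero hp hM h ?_⟩
  rw [← CP_mulVec_aPMR, h0, mulVec_zero]
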